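/- **Setting.** Let $K$ be a field. A one-loop gravity skeleton $\gamma(\omega)$ is given by an ordered partition $\omega$ of an integer into $\|\omega\|\ge 2$ positive integers, up to cyclic permutation; $|\omega|$ is the partitioned integer. (A part $j$ of $\omega$ is a vertex of the loop carrying $j$ external gravitons, hence a $(j+2)$-graviton vertex; $\|\omega\|$ is the number of vertices, and of internal propagators, of the loop.) Let $\mathcal H$ be the free commutative $K$-algebra with linear operators $B_+^{\gamma(\omega)}:\mathcal H\to\mathcal H$, one for each $\omega$ (nested insertions of one-loop graphs into the skeletons; equivalently the polynomial algebra on rooted trees decorated by skeletons), with the Hopf algebra structure determined by $$\Delta B_+^{\gamma(\omega)}=B_+^{\gamma(\omega)}\otimes 1+(\mathrm{id}\otimes B_+^{\gamma(\omega)})\Delta .$$ For power series $\Gamma^n\in 1+\alpha\mathcal H[[\alpha]]$, $n\ge 2$, put $X_\omega=\prod_{j\in\omega}\Gamma^{j+2}/[\Gamma^2]^{\|\omega\|}$. The $n$-graviton amplitudes are the solution of the Dyson–Schwinger equations $$\Gamma^n=1\pm\alpha\sum_{|\omega|=n}B_+^{\gamma(\omega)}(X_\omega),\qquad n\ge2,$$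 with the sign $-$ for $n=2$ and $+$ for $n\ge3$. Write $B_+^{1,n}=\sum_{|\omega|=n}B_+^{\gamma(\omega)}$. **Proposition.** Every $B_+^{\gamma(\omega)}$, hence every $B_+^{1,n}$, is a Hochschild one-cocycle on $\mathcal H$, and the Dyson–Schwinger equations have a unique solution $(\Gamma^n)_{n\ge2}$. Let $I\subset\mathcal H$ be the ideal generated by the coefficients of the relations $$\prod_{j\in\omega}\Gamma^{j+2}/[\Gamma^2]^{\|\omega\|}=\prod_{j\in\omega'}\Gamma^{j+2}/[\Gamma^2]^{\|\omega'\|},\qquad |\omega|=|\omega'|.$$ 1. $I$ is also the ideal generated by the coefficients of the relations $\Gamma^{n+1}/\Gamma^n=\Gamma^n/\Gamma^{n-1}$, $n\ge3$. 2. $I$ is a Hopf ideal, and in the Hopf algebra $\mathcal H/I$ the coefficients of all the series $\Gamma^n$, $n\ge 2$, generate a sub-Hopf algebra. 3. Let $J\supseteq I$ be the smallest ideal containing $I$ that is stable under all the operators $B_+^{\gamma(\omega)}$. Then $J$ is a Hopf ideal, the coefficients of the $\Gamma^n$, $n\ge 2$, generate a sub-Hopf algebra of $\mathcal H/J$, the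 operators $B_+^{\gamma(\omega)}$ descend to $\mathcal H/J$, and there the sums $B_+^{1,n}=\sum_{|\omega|=n}B_+^{\gamma(\omega)}$ are Hochschild closed, $\Delta B_+^{1,n}=B_+^{1,n}\otimes1+(\mathrm{id}\otimes B_+^{1,n})\Delta$, and generate the amplitudes: $\Gamma^{|\omega|}=1\pm\alpha B_+^{1,|\omega|}(X_\omega)$ for every $\omega$. More generally, the closedness of the $B_+^{1,n}$, the unique solvability of the Dyson–Schwinger equations and statements 1–3 hold in every commutative Hopf algebra over $K$ equipped with a Hochschild one-cocycle $B_+^{\gamma(\omega)}$ for each $\omega$. -/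

import Mathlib

open scoped TensorProduct

universe u v

namespace Gravity

/-! ### One-loop skeletons as cyclic ordered partitions -/

/-- An ordered partition into at least two positive integers, up to cyclic permutation.
It encodes a one-loop skeleton graph: a cycle of `m = ω.size` internal propagators and `m`
vertices, the `i`-th vertex carrying `n_i` external legs, so being `(n_i + 2)`-valent. -/
def CyclicPartition : Type :=
  {c : Cycle ℕ // (∀ j ∈ c, 0 < j) ∧ 2 ≤ c.length}

namespace CyclicPartition

/-- The integer `|ω|` which is partitioned: the number of external legs of the skeleton. -/
def weight (ω : CyclicPartition) : ℕ := ω.1.toMultiset.sum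

/-- The size `‖ω‖` of the partition: the number of its parts. -/
def size (ω : CyclicPartition) : ℕ := ω.1.length

theorem finite_weight_eq (r : ℕ) : {ω : CyclicPartition | ω.weight = r}.Finite := by
  have h : ((fun c : Composition r => (c.blocks : Cycle ℕ)) '' Set.univ).Finite :=
    Set.toFinite _
  refine Set.Finite.of_finite_image (f := Subtype.val) (h.subset ?_)
    Subtype.val_injective.injOn
  rintro _ ⟨⟨c, hc⟩, hr, rfl⟩
  induction c using Quotient.inductionOn' with
  | h l =>
    refine ⟨⟨l, fun {i} hi => hc.1 i hi, ?_⟩, trivial, rfl⟩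
    exact hr

/-- The set of all partitions `ω` with `|ω| = r`. -/
noncomputable def ofWeight (r : ℕ) : Finset CyclicPartition :=
  (finite_weight_eq r).toFinset

end CyclicPartition

/-! ### Hochschild one-cocycles and sub-Hopf algebras -/

section Hopf

variable (K : Type u) [Field K] {H : Type v} [CommRing H] [HopfAlgebra K H]

/-- `L` is a Hochschild one-cocycle, `b L = 0`: `Δ L = L ⊗ 1 + (id ⊗ L) Δ`. -/
def IsOneCocycle (L : H →ₗ[K] H) : Prop :=
  ∀ x : H, Coalgebra.comul (R := K) (L x) =
    L x ⊗ₜ[K] (1 : H) + L.lTensor H (Coalgebra.comul (R := K) x)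

/-- The subalgebra `A` of `H` is a sub-Hopf algebra: `Δ A ⊆ A ⊗ A` and `S A ⊆ A`. -/
structure IsSubHopfAlgebra (A : Subalgebra K H) : Prop where
  comul_mem : ∀ a ∈ A, Coalgebra.comul (R := K) a ∈
    (Algebra.TensorProduct.map A.val A.val).range
  antipode_mem : ∀ a ∈ A, HopfAlgebra.antipode K a ∈ A

end Hopf

/-! ### The combinatorial Dyson-Schwinger equations -/

section Green

variable {K : Type u} [Field K] {H : Type v} [CommRing H] [HopfAlgebra K H]

/-- The dressing `X_ω = ∏_{j ∈ ω} Γ^{j+2} / [Γ²]^‖ω‖` of the skeleton `γ(ω)`: each vertex is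
dressed by the vertex function and each internal edge by the inverse of `Γ²`. The series `Γ²`
always has constant coefficient `1` below, so `invOfUnit (Γ 2) 1` is its inverse. -/
noncomputable def dressing (Γ : ℕ → PowerSeries H) (ω : CyclicPartition) : PowerSeries H :=
  (ω.1.toMultiset.map fun j => Γ (j + 2)).prod * PowerSeries.invOfUnit (Γ 2) 1 ^ ω.size

/-- A linear operator applied to a power series coefficient by coefficient. -/
noncomputable def mapCoeff (L : H →ₗ[K] H) (φ : PowerSeries H) : PowerSeries H :=
  PowerSeries.mk fun k => L (PowerSeries.coeff k φ)

/-- The sign in the Dyson-Schwinger equation: minus for the inverse propagator (`n = 2`), plus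
for the vertex functions (`n ≥ 3`). -/
def dseSign (n : ℕ) : ℤ := if n = 2 then -1 else 1

/-- `Γ n` (for `n ≥ 2`) is the `n`-graviton amplitude, as a power series in the loop-counting
parameter `α = PowerSeries.X`, all skeletons being one-loop:
`Γⁿ = 1 ± α ∑_{|ω| = n} B_+^{γ(ω)}(X_ω)`.
For `n = 0, 1` the sum is empty and `Γ n = 1`; these two series are never used. -/
def IsGreenSystem (B : CyclicPartition → H →ₗ[K] H) (Γ : ℕ → PowerSeries H) : Prop :=
  ∀ n : ℕ, Γ n = 1 + dseSign n •
    (PowerSeries.X * ∑ ω ∈ CyclicPartition.ofWeight n, mapCoeff (B ω) (dressing Γ ω))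

/-- The operator `B_+^{1,n} = ∑_{|ω| = n} B_+^{γ(ω)}`. -/
noncomputable def oneLoop (B : CyclicPartition → H →ₗ[K] H) (n : ℕ) : H →ₗ[K] H :=
  ∑ ω ∈ CyclicPartition.ofWeight n, B ω

/-- The ideal generated by the coefficients of the relations `X_ω = X_ω'`, `|ω| = |ω'|`. -/
noncomputable def relationIdeal (Γ : ℕ → PowerSeries H) : Ideal H :=
  Ideal.span {x | ∃ (ω ω' : CyclicPartition) (k : ℕ), ω.weight = ω'.weight ∧
    x = PowerSeries.coeff k (dressing Γ ω - dressing Γ ω')}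

/-- The ideal generated by the coefficients of the relations `Γ^{n+1}/Γⁿ = Γⁿ/Γ^{n-1}`,
`n ≥ 3`. -/
noncomputable def ratioIdeal (Γ : ℕ → PowerSeries H) : Ideal H :=
  Ideal.span {x | ∃ n k : ℕ, 3 ≤ n ∧ x = PowerSeries.coeff k
    (Γ (n + 1) * PowerSeries.invOfUnit (Γ n) 1 - Γ n * PowerSeries.invOfUnit (Γ (n - 1)) 1)}

/-- The smallest ideal which contains the relations and is stable under all the insertion
operators, so that these operators descend to the quotient. -/
noncomputable def stableRelationIdeal (B : CyclicPartition → H →ₗ[K] H)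
    (Γ : ℕ → PowerSeries H) : Ideal H :=
  sInf {J | relationIdeal Γ ≤ J ∧ ∀ ω, ∀ x ∈ J, B ω x ∈ J}

/-- The subalgebra generated by all the coefficients `c_kⁿ` of the amplitudes `Γⁿ`, `n ≥ 2`. -/
noncomputable def greenSubalgebra (K : Type u) [Field K] {H : Type v} [CommRing H]
    [HopfAlgebra K H] (Γ : ℕ → PowerSeries H) : Subalgebra K H :=
  Algebra.adjoin K {x | ∃ n k : ℕ, 2 ≤ n ∧ x = PowerSeries.coeff k (Γ n)}

/-- The amplitudes in the quotient by an ideal. -/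
noncomputable def quotientGreen (I : Ideal H) (Γ : ℕ → PowerSeries H) :
    ℕ → PowerSeries (H ⧸ I) :=
  fun n => (Γ n).map (Ideal.Quotient.mk I)

end Green

/-! ### The Hopf algebra of nested insertions into one-loop skeletons -/

section Insertion

variable (K : Type u) [Field K]

/-- Formal polynomial expressions in iterated insertions into one-loop skeletons:
`ins ω t` stands for the graph obtained by inserting `t` into the skeleton `γ(ω)`. -/
inductive Term : Type u
  | scalar : K → Term
  | add : Term → Term → Term
  | mul : Term → Term → Term
  | ins : CyclicPartition → Term → Term

variable {K} in
/-- The identities between formal expressions: the laws of a commutative `K`-algebra, and the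
linearity of each insertion operator. -/
inductive Term.Rel : Term K → Term K → Prop
  | add_left {a b c} : Rel a b → Rel (.add a c) (.add b c)
  | add_right {a b c} : Rel a b → Rel (.add c a) (.add c b)
  | mul_left {a b c} : Rel a b → Rel (.mul a c) (.mul b c)
  | mul_right {a b c} : Rel a b → Rel (.mul c a) (.mul c b)
  | ins_congr {ω a b} : Rel a b → Rel (.ins ω a) (.ins ω b)
  | scalar_add {r s} : Rel (.scalar (r + s)) (.add (.scalar r) (.scalar s))
  | scalar_mul {r s} : Rel (.scalar (r * s)) (.mul (.scalar r) (.scalar s))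
  | add_comm {a b} : Rel (.add a b) (.add b a)
  | add_assoc {a b c} : Rel (.add (.add a b) c) (.add a (.add b c))
  | zero_add {a} : Rel (.add (.scalar 0) a) a
  | mul_comm {a b} : Rel (.mul a b) (.mul b a)
  | mul_assoc {a b c} : Rel (.mul (.mul a b) c) (.mul a (.mul b c))
  | one_mul {a} : Rel (.mul (.scalar 1) a) a
  | zero_mul {a} : Rel (.mul (.scalar 0) a) (.scalar 0)
  | left_distrib {a b c} : Rel (.mul a (.add b c)) (.add (.mul a b) (.mul a c))
  | ins_add {ω a b} : Rel (.ins ω (.add a b)) (.add (.ins ω a) (.ins ω b))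
  | ins_smul {ω r a} : Rel (.ins ω (.mul (.scalar r) a)) (.mul (.scalar r) (.ins ω a))

/-- The free commutative `K`-algebra with linear operators `B_+^{γ(ω)}`. It is the polynomial
algebra on the rooted trees decorated by one-loop skeletons, a tree recording how one-loop
graphs are inserted into each other. -/
def InsertionAlgebra : Type u := Quot (Term.Rel (K := K))

namespace InsertionAlgebra

instance : Add (InsertionAlgebra K) :=
  ⟨Quot.map₂ Term.add (fun _ _ _ => Term.Rel.add_right) (fun _ _ _ => Term.Rel.add_left)⟩

instance : Mul (InsertionAlgebra K) :=
  ⟨Quot.map₂ Term.mul (fun _ _ _ => Term.Rel.mul_right) (fun _ _ _ => Term.Rel.mul_left)⟩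

instance : Zero (InsertionAlgebra K) := ⟨Quot.mk _ (.scalar 0)⟩

instance : One (InsertionAlgebra K) := ⟨Quot.mk _ (.scalar 1)⟩

instance : Neg (InsertionAlgebra K) :=
  ⟨Quot.map (Term.mul (.scalar (-1))) (fun _ _ => Term.Rel.mul_right)⟩

instance : CommSemigroup (InsertionAlgebra K) where
  mul_assoc := by rintro ⟨a⟩ ⟨b⟩ ⟨c⟩; exact Quot.sound Term.Rel.mul_assoc
  mul_comm := by rintro ⟨a⟩ ⟨b⟩; exact Quot.sound Term.Rel.mul_comm

instance : AddCommSemigroup (InsertionAlgebra K) where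
  add_assoc := by rintro ⟨a⟩ ⟨b⟩ ⟨c⟩; exact Quot.sound Term.Rel.add_assoc
  add_comm := by rintro ⟨a⟩ ⟨b⟩; exact Quot.sound Term.Rel.add_comm

theorem one_mul_aux (x : InsertionAlgebra K) : 1 * x = x := by
  obtain ⟨a⟩ := x; exact Quot.sound Term.Rel.one_mul

theorem zero_mul_aux (x : InsertionAlgebra K) : 0 * x = 0 := by
  obtain ⟨a⟩ := x; exact Quot.sound Term.Rel.zero_mul

theorem zero_add_aux (x : InsertionAlgebra K) : 0 + x = x := by
  obtain ⟨a⟩ := x; exact Quot.sound Term.Rel.zero_add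

theorem mul_add_aux (x y z : InsertionAlgebra K) : x * (y + z) = x * y + x * z := by
  obtain ⟨a⟩ := x; obtain ⟨b⟩ := y; obtain ⟨c⟩ := z; exact Quot.sound Term.Rel.left_distrib

/-- The class of a formal expression. -/
def mkTerm (t : Term K) : InsertionAlgebra K := Quot.mk _ t

theorem neg_aux (x : InsertionAlgebra K) : -x = mkTerm K (.scalar (-1)) * x := by
  obtain ⟨a⟩ := x; rfl

theorem scalar_add_aux (r s : K) :
    mkTerm K (.scalar (r + s)) = mkTerm K (.scalar r) + mkTerm K (.scalar s) :=
  Quot.sound Term.Rel.scalar_add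

theorem neg_add_aux (x : InsertionAlgebra K) : -x + x = 0 := by
  have h : mkTerm K (.scalar (-1)) + 1 = 0 := by
    refine (scalar_add_aux K (-1) 1).symm.trans ?_
    rw [neg_add_cancel]; rfl
  calc -x + x = x * mkTerm K (.scalar (-1)) + x * 1 := by
        rw [neg_aux, mul_comm x, mul_comm x 1, one_mul_aux]
    _ = 0 := by rw [← mul_add_aux, h, mul_comm, zero_mul_aux]

instance : CommRing (InsertionAlgebra K) where
  nsmul := nsmulRec
  zsmul := zsmulRec
  zero_add := zero_add_aux K
  add_zero x := by rw [add_comm, zero_add_aux]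
  one_mul := one_mul_aux K
  mul_one x := by rw [mul_comm, one_mul_aux]
  zero_mul := zero_mul_aux K
  mul_zero x := by rw [mul_comm, zero_mul_aux]
  left_distrib := mul_add_aux K
  right_distrib x y z := by rw [mul_comm, mul_add_aux, mul_comm z x, mul_comm z y]
  neg_add_cancel := neg_add_aux K
  add_comm := add_comm
  mul_comm := mul_comm

theorem ins_smul_aux (ω : CyclicPartition) (r : K) (a : Term K) :
    (Quot.mk Term.Rel (.ins ω (.mul (.scalar r) a)) : InsertionAlgebra K) =
      Quot.mk Term.Rel (.mul (.scalar r) (.ins ω a)) := Quot.sound Term.Rel.ins_smul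

instance : Algebra K (InsertionAlgebra K) where
  smul r x := HMul.hMul (α := InsertionAlgebra K) (Quot.mk _ (.scalar r)) x
  algebraMap :=
    { toFun := fun r => Quot.mk _ (.scalar r)
      map_one' := rfl
      map_zero' := rfl
      map_add' := fun _ _ => Quot.sound Term.Rel.scalar_add
      map_mul' := fun _ _ => Quot.sound Term.Rel.scalar_mul }
  commutes' := fun _ _ => mul_comm _ _
  smul_def' := fun _ _ => rfl

/-- The insertion operator `B_+^{γ(ω)}`. -/
def insertion (ω : CyclicPartition) : InsertionAlgebra K →ₗ[K] InsertionAlgebra K where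
  toFun := Quot.map (Term.ins ω) (fun _ _ => Term.Rel.ins_congr)
  map_add' := by rintro ⟨a⟩ ⟨b⟩; exact Quot.sound Term.Rel.ins_add
  map_smul' := by rintro r ⟨a⟩; exact ins_smul_aux K ω r a

variable {K}

theorem induct {P : InsertionAlgebra K → Prop} (hs : ∀ r : K, P (algebraMap K _ r))
    (ha : ∀ x y, P x → P y → P (x + y)) (hm : ∀ x y, P x → P y → P (x * y))
    (hi : ∀ ω x, P x → P (insertion K ω x)) (x : InsertionAlgebra K) : P x := by
  obtain ⟨t⟩ := x
  induction t with
  | scalar r => exact hs r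
  | add a b iha ihb => exact ha _ _ iha ihb
  | mul a b iha ihb => exact hm _ _ iha ihb
  | ins ω a iha => exact hi ω _ iha

theorem algHom_ext {E : Type v} [CommRing E] [Algebra K E] {f g : InsertionAlgebra K →ₐ[K] E}
    (h : ∀ ω x, f x = g x → f (insertion K ω x) = g (insertion K ω x)) : f = g := by
  ext x
  induction x using induct with
  | hs r => simp
  | ha x y hx hy => simp [hx, hy]
  | hm x y hx hy => simp [hx, hy]
  | hi ω x hx => exact h ω x hx

section Lift

variable {E : Type v} [CommRing E] [Algebra K E] (L : CyclicPartition → E →ₗ[K] E)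

/-- Evaluation of a formal expression in a commutative algebra with operators. -/
def interp : Term K → E
  | .scalar r => algebraMap K E r
  | .add a b => interp a + interp b
  | .mul a b => interp a * interp b
  | .ins ω a => L ω (interp a)

theorem interp_rel {a b : Term K} (h : Term.Rel a b) : interp L a = interp L b := by
  induction h <;> simp only [interp, map_add, map_mul, map_zero, map_one] <;>
    first
    | simp_all
    | ring
    | simp only [← Algebra.smul_def, map_smul]

theorem mk_scalar (r : K) :
    algebraMap K (InsertionAlgebra K) r = Quot.mk _ (.scalar r) := rfl

theorem lift_scalar (r : K) : Quot.lift (interp L) (fun _ _ => interp_rel L)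
    (algebraMap K (InsertionAlgebra K) r) = algebraMap K E r := by
  rw [mk_scalar]; simp only [interp]

/-- The universal property of the insertion algebra. -/
def lift : InsertionAlgebra K →ₐ[K] E where
  toFun := Quot.lift (interp L) (fun _ _ => interp_rel L)
  map_one' := map_one (algebraMap K E)
  map_zero' := map_zero (algebraMap K E)
  map_mul' := by rintro ⟨a⟩ ⟨b⟩; rfl
  map_add' := by rintro ⟨a⟩ ⟨b⟩; rfl
  commutes' := fun r => lift_scalar L r

theorem lift_insertion (ω : CyclicPartition) (x : InsertionAlgebra K) :
    lift L (insertion K ω x) = L ω (lift L x) := by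
  obtain ⟨a⟩ := x; rfl

end Lift

variable (K)

/-- The operators `(x, y) ↦ (B_+ x, B_+ x ⊗ 1 + (id ⊗ B_+) y)` used to define `Δ`. -/
noncomputable def comulOp (ω : CyclicPartition) :
    (InsertionAlgebra K × (InsertionAlgebra K ⊗[K] InsertionAlgebra K)) →ₗ[K]
      (InsertionAlgebra K × (InsertionAlgebra K ⊗[K] InsertionAlgebra K)) :=
  (insertion K ω ∘ₗ LinearMap.fst K _ _).prod
    ((TensorProduct.mk K _ _).flip 1 ∘ₗ insertion K ω ∘ₗ LinearMap.fst K _ _ +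
      (insertion K ω).lTensor (InsertionAlgebra K) ∘ₗ LinearMap.snd K _ _)

/-- The coproduct, the algebra homomorphism with
`Δ (B_+ x) = B_+ x ⊗ 1 + (id ⊗ B_+) (Δ x)` for each insertion operator `B_+`. -/
noncomputable def comulHom :
    InsertionAlgebra K →ₐ[K] InsertionAlgebra K ⊗[K] InsertionAlgebra K :=
  (AlgHom.snd K _ _).comp (lift (comulOp K))

/-- The counit, the algebra homomorphism vanishing on the image of each insertion operator. -/
noncomputable def counitHom : InsertionAlgebra K →ₐ[K] K := lift fun _ => 0

theorem counitHom_insertion (ω : CyclicPartition) (x : InsertionAlgebra K) :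
    counitHom K (insertion K ω x) = 0 := by
  rw [counitHom, lift_insertion]; rfl

theorem fst_lift_comulOp : (AlgHom.fst K _ _).comp (lift (comulOp K)) =
    AlgHom.id K (InsertionAlgebra K) := by
  refine algHom_ext fun ω x h => ?_
  simp only [AlgHom.comp_apply, AlgHom.id_apply, AlgHom.fst_apply] at h ⊢
  rw [lift_insertion]
  simp [comulOp, h]

theorem comulHom_insertion (ω : CyclicPartition) (x : InsertionAlgebra K) :
    comulHom K (insertion K ω x) = insertion K ω x ⊗ₜ[K] 1 +
      (insertion K ω).lTensor (InsertionAlgebra K) (comulHom K x) := by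
  have h := DFunLike.congr_fun (fst_lift_comulOp K) x
  simp only [AlgHom.comp_apply, AlgHom.id_apply, AlgHom.fst_apply] at h
  simp only [comulHom, AlgHom.comp_apply, AlgHom.snd_apply, lift_insertion]
  simp [comulOp, h]

theorem comulHom_comp_insertion (ω : CyclicPartition) :
    (comulHom K).toLinearMap ∘ₗ insertion K ω =
      (TensorProduct.mk K _ _).flip 1 ∘ₗ insertion K ω +
      (insertion K ω).lTensor (InsertionAlgebra K) ∘ₗ (comulHom K).toLinearMap := by
  ext x
  exact comulHom_insertion K ω x

noncomputable instance : Bialgebra K (InsertionAlgebra K) := by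
  refine .ofAlgHom (comulHom K) (counitHom K) ?_ ?_ ?_
  · refine algHom_ext fun ω x h => ?_
    simp only [AlgHom.comp_apply] at h ⊢
    have e1 : ∀ z : InsertionAlgebra K ⊗[K] InsertionAlgebra K,
        (Algebra.TensorProduct.assoc K K K _ _ _).toAlgHom
          (Algebra.TensorProduct.map (comulHom K) (.id K (InsertionAlgebra K))
            ((insertion K ω).lTensor _ z)) =
        ((insertion K ω).lTensor _).lTensor _
          ((Algebra.TensorProduct.assoc K K K _ _ _).toAlgHom
          (Algebra.TensorProduct.map (comulHom K) (.id K (InsertionAlgebra K)) z)) := by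
      intro z
      induction z with
      | zero => simp
      | add a b ha hb => simp only [map_add, ha, hb]
      | tmul a b =>
        simp only [LinearMap.lTensor_tmul, Algebra.TensorProduct.map_tmul, AlgHom.id_apply]
        induction comulHom K a with
        | zero => simp
        | add a b ha hb => simp only [TensorProduct.add_tmul, map_add, ha, hb]
        | tmul c d => simp
    have e2 : ∀ z : InsertionAlgebra K ⊗[K] InsertionAlgebra K,
        Algebra.TensorProduct.map (.id K (InsertionAlgebra K)) (comulHom K)
            ((insertion K ω).lTensor _ z) =
        (Algebra.TensorProduct.assoc K K K _ _ _).toAlgHom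
          ((insertion K ω).lTensor _ z ⊗ₜ[K] (1 : InsertionAlgebra K)) +
        ((insertion K ω).lTensor _).lTensor _
          (Algebra.TensorProduct.map (.id K (InsertionAlgebra K)) (comulHom K) z) := by
      intro z
      induction z with
      | zero => simp
      | add a b ha hb => simp only [map_add, TensorProduct.add_tmul, ha, hb]; abel
      | tmul a b => simp [comulHom_insertion, TensorProduct.tmul_add]
    rw [comulHom_insertion, map_add, map_add, map_add, e1, h, e2, Algebra.TensorProduct.map_tmul,
      comulHom_insertion, TensorProduct.add_tmul, map_add, Algebra.TensorProduct.map_tmul]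
    simp only [AlgHom.id_apply, map_one, add_assoc]
    congr 1
  · refine algHom_ext fun ω x h => ?_
    simp only [AlgHom.comp_apply] at h ⊢
    have e1 : ∀ z : InsertionAlgebra K ⊗[K] InsertionAlgebra K,
        Algebra.TensorProduct.map (counitHom K) (.id K (InsertionAlgebra K))
            ((insertion K ω).lTensor _ z) =
        (insertion K ω).lTensor _
          (Algebra.TensorProduct.map (counitHom K) (.id K (InsertionAlgebra K)) z) := by
      intro z
      induction z with
      | zero => simp
      | add a b ha hb => simp only [map_add, ha, hb]
      | tmul a b => simp
    rw [comulHom_insertion, map_add, e1, h, Algebra.TensorProduct.map_tmul, counitHom_insertion]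
    simp
  · refine algHom_ext fun ω x h => ?_
    simp only [AlgHom.comp_apply] at h ⊢
    have e1 : ∀ z : InsertionAlgebra K ⊗[K] InsertionAlgebra K,
        Algebra.TensorProduct.map (.id K (InsertionAlgebra K)) (counitHom K)
            ((insertion K ω).lTensor _ z) = 0 := by
      intro z
      induction z with
      | zero => simp
      | add a b ha hb => simp only [map_add, ha, hb, add_zero]
      | tmul a b => simp [counitHom_insertion]
    rw [comulHom_insertion, map_add, e1]
    simp

theorem isOneCocycleAux (ω : CyclicPartition) (x : InsertionAlgebra K) :
    Coalgebra.comul (R := K) (insertion K ω x) = insertion K ω x ⊗ₜ[K] 1 +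
      (insertion K ω).lTensor (InsertionAlgebra K) (Coalgebra.comul (R := K) x) :=
  comulHom_insertion K ω x

theorem counit_insertion (ω : CyclicPartition) (x : InsertionAlgebra K) :
    Coalgebra.counit (R := K) (insertion K ω x) = 0 :=
  counitHom_insertion K ω x

/-- The operators `y ↦ - m (id ⊗ B_+) y ⊗ 1 + (id ⊗ B_+) y` used to define `S`. -/
noncomputable def antipodeOp (ω : CyclicPartition) :
    (InsertionAlgebra K ⊗[K] InsertionAlgebra K) →ₗ[K]
      (InsertionAlgebra K ⊗[K] InsertionAlgebra K) :=
  (LinearMap.id - (TensorProduct.mk K _ _).flip 1 ∘ₗ LinearMap.mul' K _) ∘ₗ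
    (insertion K ω).lTensor (InsertionAlgebra K)

/-- The antipode, with `S (B_+ x) = - m (S ⊗ B_+) (Δ x)` for each insertion operator. -/
noncomputable def antipodeHom : InsertionAlgebra K →ₐ[K] InsertionAlgebra K :=
  ((Algebra.TensorProduct.rid K K _).toAlgHom.comp
    (Algebra.TensorProduct.map (.id K _) (counitHom K))).comp (lift (antipodeOp K))

theorem lift_antipodeOp_insertion (ω : CyclicPartition) (x : InsertionAlgebra K) :
    lift (antipodeOp K) (insertion K ω x) =
      (insertion K ω).lTensor (InsertionAlgebra K) (lift (antipodeOp K) x) -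
      LinearMap.mul' K _ ((insertion K ω).lTensor (InsertionAlgebra K)
        (lift (antipodeOp K) x)) ⊗ₜ[K] 1 := by
  rw [lift_insertion]; rfl

theorem rid_counit_lTensor (ω : CyclicPartition)
    (z : InsertionAlgebra K ⊗[K] InsertionAlgebra K) :
    Algebra.TensorProduct.rid K K _ (Algebra.TensorProduct.map (.id K _) (counitHom K)
      ((insertion K ω).lTensor (InsertionAlgebra K) z)) = 0 := by
  induction z with
  | zero => simp
  | add a b ha hb => simp only [map_add, ha, hb, add_zero]
  | tmul a b => simp [counitHom_insertion]

theorem antipodeHom_insertion_aux (ω : CyclicPartition) (x : InsertionAlgebra K) :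
    antipodeHom K (insertion K ω x) =
      - LinearMap.mul' K _ ((insertion K ω).lTensor (InsertionAlgebra K)
        (lift (antipodeOp K) x)) := by
  have h := rid_counit_lTensor K ω (lift (antipodeOp K) x)
  have h2 : antipodeHom K (insertion K ω x) = Algebra.TensorProduct.rid K K _
      (Algebra.TensorProduct.map (.id K _) (counitHom K)
        (lift (antipodeOp K) (insertion K ω x))) := rfl
  rw [h2, lift_antipodeOp_insertion, map_sub, map_sub, h]
  simp

theorem map_antipode_lTensor (ω : CyclicPartition)
    (z : InsertionAlgebra K ⊗[K] InsertionAlgebra K) :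
    Algebra.TensorProduct.map (antipodeHom K) (.id K (InsertionAlgebra K))
        ((insertion K ω).lTensor (InsertionAlgebra K) z) =
      (insertion K ω).lTensor (InsertionAlgebra K)
        (Algebra.TensorProduct.map (antipodeHom K) (.id K (InsertionAlgebra K)) z) := by
  induction z with
  | zero => simp
  | add a b ha hb => simp only [map_add, ha, hb]
  | tmul a b => simp

theorem lift_antipodeOp : lift (antipodeOp K) =
    (Algebra.TensorProduct.map (antipodeHom K) (.id K (InsertionAlgebra K))).comp
      (comulHom K) := by
  refine algHom_ext fun ω x h => ?_
  simp only [AlgHom.comp_apply] at h ⊢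
  rw [comulHom_insertion, map_add, map_antipode_lTensor, ← h, lift_antipodeOp_insertion,
    Algebra.TensorProduct.map_tmul, antipodeHom_insertion_aux, map_one, TensorProduct.neg_tmul]
  abel

/-- `(S * id) = η ε`. -/
theorem antipode_left : (Algebra.TensorProduct.lmul' K (S := InsertionAlgebra K)).comp
    ((Algebra.TensorProduct.map (antipodeHom K) (.id K (InsertionAlgebra K))).comp
      (comulHom K)) = (Algebra.ofId K (InsertionAlgebra K)).comp (counitHom K) := by
  rw [← lift_antipodeOp]
  refine algHom_ext fun ω x _ => ?_
  simp only [AlgHom.comp_apply, counitHom_insertion, lift_antipodeOp_insertion, map_sub, map_zero]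
  rw [Algebra.TensorProduct.lmul'_apply_tmul, mul_one]
  exact sub_self _

theorem conv_aux {R : Type u} [Ring R] (a s b c w : R) (h : c = -(s * b)) (hw : w = a * s) :
    a * c = -(w * b) := by
  rw [h, hw, mul_neg, mul_assoc]

open WithConv in
/-- `(id * S) = η ε`. -/
theorem antipode_right : (Algebra.TensorProduct.lmul' K (S := InsertionAlgebra K)).comp
    ((Algebra.TensorProduct.map (.id K (InsertionAlgebra K)) (antipodeHom K)).comp
      (comulHom K)) = (Algebra.ofId K (InsertionAlgebra K)).comp (counitHom K) := by
  set U : InsertionAlgebra K →ₐ[K] InsertionAlgebra K :=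
    (Algebra.TensorProduct.lmul' K (S := InsertionAlgebra K)).comp
    ((Algebra.TensorProduct.map (.id K (InsertionAlgebra K)) (antipodeHom K)).comp
      (comulHom K)) with hU
  have hconv : ∀ f g : InsertionAlgebra K →ₗ[K] InsertionAlgebra K,
      (toConv f * toConv g).ofConv =
        LinearMap.mul' K _ ∘ₗ TensorProduct.map f g ∘ₗ (comulHom K).toLinearMap :=
    fun f g => rfl
  have hS : ∀ ω, toConv ((antipodeHom K).toLinearMap ∘ₗ insertion K ω) =
      -(toConv (antipodeHom K).toLinearMap * toConv (insertion K ω)) := by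
    intro ω
    apply ofConv_injective
    ext x
    have e := antipodeHom_insertion_aux K ω x
    have e2 : lift (antipodeOp K) x = Algebra.TensorProduct.map (antipodeHom K)
        (.id K (InsertionAlgebra K)) (comulHom K x) :=
      DFunLike.congr_fun (lift_antipodeOp K) x
    refine e.trans ?_
    rw [e2, ofConv_neg, hconv]
    simp only [LinearMap.neg_apply, LinearMap.comp_apply]
    congr 2
    change _ = TensorProduct.map (antipodeHom K).toLinearMap (insertion K ω) (comulHom K x)
    generalize (comulHom K) x = z
    induction z with
    | zero => simp
    | add a b ha hb => simp only [map_add, ha, hb]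
    | tmul a b => simp
  have hUc : toConv U.toLinearMap =
      toConv LinearMap.id * toConv (antipodeHom K).toLinearMap := by
    apply ofConv_injective
    rw [hconv]; rfl
  have hUB : ∀ ω x, U (insertion K ω x) = insertion K ω x -
      (toConv U.toLinearMap * toConv (insertion K ω)).ofConv x := by
    intro ω x
    have e : U (insertion K ω x) = insertion K ω x +
        (toConv LinearMap.id * toConv ((antipodeHom K).toLinearMap ∘ₗ insertion K ω)).ofConv x := by
      simp only [hU, AlgHom.comp_apply, comulHom_insertion, map_add, hconv, LinearMap.comp_apply]
      congr 1
      · simp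
      · change _ = LinearMap.mul' K _ (TensorProduct.map _ _ (comulHom K x))
        generalize (comulHom K) x = z
        induction z with
        | zero => simp
        | add a b ha hb => simp only [map_add, ha, hb]
        | tmul a b => simp
    have e4 : toConv (LinearMap.id : InsertionAlgebra K →ₗ[K] InsertionAlgebra K) *
        toConv ((antipodeHom K).toLinearMap ∘ₗ insertion K ω) =
        -(toConv U.toLinearMap * toConv (insertion K ω)) := by
      exact conv_aux _ _ _ _ _ (hS ω) hUc
    rw [e, e4, ofConv_neg, LinearMap.neg_apply, sub_eq_add_neg]
  have hV : (Algebra.TensorProduct.map U (.id K (InsertionAlgebra K))).comp (comulHom K) =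
      Algebra.TensorProduct.includeRight := by
    refine algHom_ext fun ω x h => ?_
    simp only [AlgHom.comp_apply, Algebra.TensorProduct.includeRight_apply] at h ⊢
    have e1 : ∀ z : InsertionAlgebra K ⊗[K] InsertionAlgebra K,
        Algebra.TensorProduct.map U (.id K (InsertionAlgebra K))
            ((insertion K ω).lTensor _ z) =
        (insertion K ω).lTensor _
          (Algebra.TensorProduct.map U (.id K (InsertionAlgebra K)) z) := by
      intro z
      induction z with
      | zero => simp
      | add a b ha hb => simp only [map_add, ha, hb]
      | tmul a b => simp
    have e2 : (toConv U.toLinearMap * toConv (insertion K ω)).ofConv x = insertion K ω x := by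
      have e3 : (toConv U.toLinearMap * toConv (insertion K ω)).ofConv x =
          LinearMap.mul' K _ ((insertion K ω).lTensor _
            (Algebra.TensorProduct.map U (.id K (InsertionAlgebra K)) (comulHom K x))) := by
        rw [hconv]
        change LinearMap.mul' K _ (TensorProduct.map _ _ (comulHom K x)) = _
        generalize (comulHom K) x = z
        induction z with
        | zero => simp
        | add a b ha hb => simp only [map_add, ha, hb]
        | tmul a b => simp
      rw [e3, h]; simp
    rw [comulHom_insertion, map_add, e1, h, Algebra.TensorProduct.map_tmul, hUB, e2, sub_self]
    simp
  refine algHom_ext fun ω x h => ?_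
  have hx := DFunLike.congr_fun hV x
  simp only [AlgHom.comp_apply, Algebra.TensorProduct.includeRight_apply] at hx
  have e2 : (toConv U.toLinearMap * toConv (insertion K ω)).ofConv x = insertion K ω x := by
    have e3 : (toConv U.toLinearMap * toConv (insertion K ω)).ofConv x =
        LinearMap.mul' K _ ((insertion K ω).lTensor _
          (Algebra.TensorProduct.map U (.id K (InsertionAlgebra K)) (comulHom K x))) := by
      rw [hconv]
      change LinearMap.mul' K _ (TensorProduct.map _ _ (comulHom K x)) = _
      generalize (comulHom K) x = z
      induction z with
      | zero => simp
      | add a b ha hb => simp only [map_add, ha, hb]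
      | tmul a b => simp
    rw [e3, hx]; simp
  rw [hUB, e2, sub_self, AlgHom.comp_apply, counitHom_insertion, map_zero]

noncomputable instance : HopfAlgebra K (InsertionAlgebra K) where
  antipode := (antipodeHom K).toLinearMap
  mul_antipode_rTensor_comul := congrArg AlgHom.toLinearMap (antipode_left K)
  mul_antipode_lTensor_comul := congrArg AlgHom.toLinearMap (antipode_right K)

end InsertionAlgebra

end Insertion

/-! ### The generalized Slavnov-Taylor relations -/

/-- Let `Γ` be the solution of the Dyson-Schwinger equations for the insertion operators `B`.
* The relations `X_ω = X_ω'`, `|ω| = |ω'|`, and the relations `Γ^{n+1}/Γⁿ = Γⁿ/Γ^{n-1}`, `n ≥ 3`,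
  generate the same ideal; it is a Hopf ideal, and in the quotient by it the coefficients of all
  the amplitudes generate a sub-Hopf algebra.
* The same two facts hold for the smallest ideal which contains the relations and is stable
  under the insertions. In the quotient by it, where all insertion operators are defined, each
  `B_+^{1,n} = ∑_{|ω| = n} B_+^{γ(ω)}` is a Hochschild one-cocycle, and it alone generates the
  `n`-graviton amplitude: `Γⁿ = 1 ± α B_+^{1,n}(X_ω)` for any `ω` with `|ω| = n`. -/
def SlavnovTaylor {K : Type u} [Field K] {H : Type v} [CommRing H] [HopfAlgebra K H]
    (B : CyclicPartition → H →ₗ[K] H) : Prop :=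
  (∀ n : ℕ, IsOneCocycle K (oneLoop B n)) ∧
  (∃! Γ : ℕ → PowerSeries H, IsGreenSystem B Γ) ∧
  ∀ Γ : ℕ → PowerSeries H, IsGreenSystem B Γ →
    relationIdeal Γ = ratioIdeal Γ ∧
    (∃ _ : (relationIdeal Γ).IsHopfIdeal K,
      IsSubHopfAlgebra K (greenSubalgebra K (quotientGreen (relationIdeal Γ) Γ))) ∧
    (∃ _ : (stableRelationIdeal B Γ).IsHopfIdeal K,
      IsSubHopfAlgebra K (greenSubalgebra K (quotientGreen (stableRelationIdeal B Γ) Γ)) ∧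
      ∃ B' : CyclicPartition →
          (H ⧸ stableRelationIdeal B Γ) →ₗ[K] (H ⧸ stableRelationIdeal B Γ),
        (∀ ω x, B' ω (Ideal.Quotient.mk _ x) = Ideal.Quotient.mk _ (B ω x)) ∧
        (∀ n : ℕ, IsOneCocycle K (oneLoop B' n)) ∧
        ∀ ω : CyclicPartition,
          quotientGreen (stableRelationIdeal B Γ) Γ ω.weight =
            1 + dseSign ω.weight • (PowerSeries.X * mapCoeff (oneLoop B' ω.weight)
              (dressing (quotientGreen (stableRelationIdeal B Γ) Γ) ω)))

end Gravity

/-!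
The heart of the argument is the coproduct formula `map_leftComul_green`. Let `p` be an algebra
homomorphism from `H` such that the series `p Γⁿ` have an invariant charge: a series `Q` with
`X_ω = Γ^|ω| Q` for all `ω`. Then `(p ⊗ id) Δ Γⁿ(α) = p Γⁿ(α) ⊗ Γⁿ(αQ)`, where the powers of
`Q` produced by the substitution `α ↦ αQ` (`stretch`) are placed in the left factor. Indeed both
sides solve the Dyson-Schwinger equations for the operators `id ⊗ B_+` with the inhomogeneous terms
`p Γⁿ ⊗ 1`: the left side by the cocycle property, the right side by the invariance of the charge.
Such equations have exactly one solution, their right-hand side being an `α`-adic contraction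
(`dse_exists`, `dse_unique`). It is decisive that only the left factor needs the relations: this
is why the ideal of relations, which is not stable under the insertions, is already a Hopf ideal.

Both families of relations say that `Γⁿ = Γ² qⁿ⁻²` with `q = Γ³/Γ²` (`relations_tfae`). Then
`X_ω = q^|ω|`, and `Q = q²/Γ²` is an invariant charge. So the formula applies to the projection
`p` onto the quotient by any ideal containing the relations, and it yields the following.

* Projecting the right factor too, `(p ⊗ p) Δ X_ω` depends on `|ω|` only, so that the relations
  generate a coideal; and the coefficients of the amplitudes generate a subalgebra `A` of the
  quotient with `Δ A ⊆ A ⊗ A`, because `Q` has coefficients in `A`.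
* Applying the antipode on the right and multiplying, `p Γⁿ(α) · (p S Γⁿ)(αQ) = 1`
  (`twist_antipode_green`). As `α ↦ αQ` is multiplicative, injective and triangular, `S` preserves
  the ideal of relations as well as `A`.

For the stable ideal `J`, adjoining to a Hopf ideal its images under one-cocycles `L` gives a Hopf
ideal, by `S ∘ L = -(S * L)` (`isHopfIdeal_sup_span`). Hence the largest Hopf ideal inside `J` is
stable, and so is all of `J`. In the quotient by `J` the dressings of equal weight agree, and the
sum over the skeletons in the Dyson-Schwinger equation collapses to `B_+^{1,n}`.
-/

namespace Gravity

open PowerSeries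

/-! ### Power series with constant coefficient one -/

section Series

variable {R S : Type*} [CommRing R] [CommRing S]

theorem mul_invOfUnit_one {φ : PowerSeries R} (h : constantCoeff φ = 1) :
    φ * invOfUnit φ 1 = 1 :=
  mul_invOfUnit φ 1 (by simpa using h)

theorem eq_invOfUnit_one {φ ψ : PowerSeries R} (h : constantCoeff φ = 1) (e : ψ * φ = 1) :
    ψ = invOfUnit φ 1 :=
  left_inv_eq_right_inv e (mul_invOfUnit_one h)

/-- A ring homomorphism to an arbitrary ring sends the dressing to the expression built from the
images of the amplitudes and an inverse `u` of the image of `Γ²`. -/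
theorem map_dressing_eq (g : PowerSeries R →+* S) {Γ : ℕ → PowerSeries R}
    (h : constantCoeff (Γ 2) = 1) (ω : CyclicPartition) {u : S} (hu : u * g (Γ 2) = 1) :
    g (dressing Γ ω) = (ω.1.toMultiset.map fun j => g (Γ (j + 2))).prod * u ^ ω.size := by
  have e : g (invOfUnit (Γ 2) 1) = u := by
    refine (left_inv_eq_right_inv hu ?_).symm
    rw [← map_mul, mul_invOfUnit_one h, map_one]
  rw [dressing, map_mul, map_pow, e, map_multiset_prod, Multiset.map_map]
  rfl

theorem map_dressing (g : PowerSeries R →+* PowerSeries S) {Γ : ℕ → PowerSeries R}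
    (h : constantCoeff (Γ 2) = 1) (h' : constantCoeff (g (Γ 2)) = 1) (ω : CyclicPartition) :
    g (dressing Γ ω) = dressing (fun n => g (Γ n)) ω :=
  map_dressing_eq g h ω (by rw [mul_comm, mul_invOfUnit_one h'])

theorem constantCoeff_map_eq_one (f : R →+* S) {φ : PowerSeries R}
    (h : constantCoeff φ = 1) : constantCoeff (PowerSeries.map f φ) = 1 := by
  rw [← coeff_zero_eq_constantCoeff_apply, coeff_map, coeff_zero_eq_constantCoeff_apply, h,
    map_one]

theorem map_coeff_dressing (f : R →+* S) {Γ : ℕ → PowerSeries R}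
    (h : constantCoeff (Γ 2) = 1) (ω : CyclicPartition) :
    PowerSeries.map f (dressing Γ ω) = dressing (fun n => PowerSeries.map f (Γ n)) ω :=
  map_dressing _ h (constantCoeff_map_eq_one f h) ω

theorem dressing_mul {Φ Ψ : ℕ → PowerSeries R} (hΦ : constantCoeff (Φ 2) = 1)
    (hΨ : constantCoeff (Ψ 2) = 1) (ω : CyclicPartition) :
    dressing (fun n => Φ n * Ψ n) ω = dressing Φ ω * dressing Ψ ω := by
  have e : invOfUnit (Φ 2 * Ψ 2) 1 = invOfUnit (Φ 2) 1 * invOfUnit (Ψ 2) 1 := by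
    refine (eq_invOfUnit_one (by simp [hΦ, hΨ]) ?_).symm
    linear_combination (invOfUnit (Ψ 2) 1 * Ψ 2) * mul_invOfUnit_one hΦ + mul_invOfUnit_one hΨ
  simp only [dressing, e, Multiset.prod_map_mul, mul_pow]
  ring

theorem dressing_one (ω : CyclicPartition) :
    dressing (fun _ => (1 : PowerSeries R)) ω = 1 := by
  have e : invOfUnit (1 : PowerSeries R) 1 = 1 :=
    (eq_invOfUnit_one (by simp) (one_mul 1)).symm
  simp [dressing, e]

/-- The dressing is continuous: modulo `α^k` it only depends on the amplitudes modulo `α^k`. -/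
theorem dressing_congr {Φ Ψ : ℕ → PowerSeries R} (hΦ : constantCoeff (Φ 2) = 1)
    (hΨ : constantCoeff (Ψ 2) = 1) {k : ℕ} (h : ∀ n, (X : PowerSeries R) ^ k ∣ Φ n - Ψ n)
    (ω : CyclicPartition) : (X : PowerSeries R) ^ k ∣ dressing Φ ω - dressing Ψ ω := by
  set g := Ideal.Quotient.mk (Ideal.span {(X : PowerSeries R) ^ k}) with hg
  have e : ∀ n, g (Φ n) = g (Ψ n) := fun n => by
    rw [hg, Ideal.Quotient.eq, Ideal.mem_span_singleton]; exact h n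
  have hu : g (invOfUnit (Ψ 2) 1) * g (Ψ 2) = 1 := by
    rw [← map_mul, mul_comm, mul_invOfUnit_one hΨ, map_one]
  rw [← Ideal.mem_span_singleton, ← Ideal.Quotient.eq, ← hg, map_dressing_eq g hΨ ω hu,
    map_dressing_eq g hΦ ω ((e 2).symm ▸ hu)]
  simp only [e]

theorem invOfUnit_mem_range_map (f : S →+* R) {φ : PowerSeries R}
    (hf : Function.Injective f) (h : constantCoeff φ = 1) (hφ : φ ∈ (PowerSeries.map f).range) :
    invOfUnit φ 1 ∈ (PowerSeries.map f).range := by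
  obtain ⟨ψ, rfl⟩ := hφ
  have h' : constantCoeff ψ = 1 := hf (by
    rw [map_one, ← h, ← coeff_zero_eq_constantCoeff_apply, ← coeff_zero_eq_constantCoeff_apply,
      coeff_map])
  refine ⟨invOfUnit ψ 1, eq_invOfUnit_one h ?_⟩
  rw [← map_mul, mul_comm, mul_invOfUnit_one h', map_one]

/-! ### The substitution `α ↦ α Q` -/

theorem hasSubst_X_mul (Q : PowerSeries R) : HasSubst (X * Q : PowerSeries R) :=
  HasSubst.of_constantCoeff_zero' (by simp)

/-- The substitution `α ↦ α Q`, an endomorphism of the ring of power series. -/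
noncomputable def stretch (Q : PowerSeries R) : PowerSeries R →+* PowerSeries R :=
  (substAlgHom (R := R) (hasSubst_X_mul Q)).toRingHom

theorem coeff_stretch (Q φ : PowerSeries R) (k : ℕ) : coeff k (stretch Q φ) =
    ∑ j ∈ Finset.range (k + 1), coeff j φ * coeff (k - j) (Q ^ j) := by
  have h : stretch Q φ = subst (X * Q : PowerSeries R) φ :=
    congrFun (coe_substAlgHom (R := R) (hasSubst_X_mul Q)) φ
  rw [h, coeff_subst' (hasSubst_X_mul Q),
    finsum_eq_sum_of_support_subset (s := Finset.range (k + 1))]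
  · refine Finset.sum_congr rfl fun j hj => ?_
    rw [smul_eq_mul, mul_pow, coeff_X_pow_mul', if_pos (by simpa [Nat.lt_succ_iff] using hj)]
  · intro j hj
    contrapose! hj
    simp only [Finset.coe_range, Set.mem_Iio, not_lt] at hj
    rw [Function.notMem_support, smul_eq_mul, mul_pow, coeff_X_pow_mul',
      if_neg (by omega), mul_zero]

theorem stretch_X (Q : PowerSeries R) : stretch Q X = X * Q :=
  substAlgHom_X (R := R) (hasSubst_X_mul Q)

theorem constantCoeff_stretch (Q φ : PowerSeries R) :
    constantCoeff (stretch Q φ) = constantCoeff φ := by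
  rw [← coeff_zero_eq_constantCoeff_apply, coeff_stretch]
  simp

theorem map_stretch (f : R →+* S) (Q φ : PowerSeries R) :
    PowerSeries.map f (stretch Q φ) = stretch (PowerSeries.map f Q) (PowerSeries.map f φ) := by
  ext k
  simp only [coeff_map, coeff_stretch, map_sum, map_mul, ← map_pow]

/-- The substitution `α ↦ α Q` is triangular with unit diagonal if `Q` has constant
coefficient one. -/
theorem coeff_stretch_succ {Q : PowerSeries R} (hQ : constantCoeff Q = 1) (φ : PowerSeries R)
    (k : ℕ) : coeff k (stretch Q φ) =
      ∑ j ∈ Finset.range k, coeff j φ * coeff (k - j) (Q ^ j) + coeff k φ := by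
  rw [coeff_stretch, Finset.sum_range_succ]
  simp [hQ]

theorem stretch_injective {Q : PowerSeries R} (hQ : constantCoeff Q = 1) :
    Function.Injective (stretch Q) := by
  intro φ ψ h
  ext k
  induction k using Nat.strong_induction_on with
  | _ k ih =>
    have e := congrArg (coeff k) h
    rw [coeff_stretch_succ hQ, coeff_stretch_succ hQ,
      Finset.sum_congr rfl fun j hj => by rw [ih j (Finset.mem_range.mp hj)]] at e
    exact add_left_cancel e

theorem mem_range_map_iff (A : Subring R) (φ : PowerSeries R) :
    φ ∈ (PowerSeries.map A.subtype).range ↔ ∀ k, coeff k φ ∈ A := by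
  constructor
  · rintro ⟨ψ, rfl⟩ k
    simp
  · intro h
    exact ⟨PowerSeries.mk fun k => ⟨coeff k φ, h k⟩, by ext k; simp⟩

theorem coeff_mem_of_stretch {A : Subring R} {Q φ : PowerSeries R} (hQ : constantCoeff Q = 1)
    (hQA : Q ∈ (PowerSeries.map A.subtype).range)
    (h : stretch Q φ ∈ (PowerSeries.map A.subtype).range) (k : ℕ) : coeff k φ ∈ A := by
  induction k using Nat.strong_induction_on with
  | _ k ih =>
    rw [eq_sub_of_add_eq' (coeff_stretch_succ hQ φ k).symm]
    refine A.sub_mem ((mem_range_map_iff A _).mp h k) (A.sum_mem fun j hj => A.mul_mem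
      (ih j (Finset.mem_range.mp hj)) ((mem_range_map_iff A _).mp (pow_mem hQA j) _))

/-! ### The relations between the amplitudes -/

/-- If the amplitudes form a geometric progression of ratio `q` then every dressing is
`q ^ |ω|`, because a vertex with `j` legs together with one edge contributes `q ^ j`. -/
theorem dressing_eq_pow_weight {Γ : ℕ → PowerSeries R} (h : constantCoeff (Γ 2) = 1)
    {q : PowerSeries R} (hq : ∀ j, Γ (j + 2) = Γ 2 * q ^ j) (ω : CyclicPartition) :
    dressing Γ ω = q ^ ω.weight := by
  obtain ⟨⟨l⟩, hl⟩ := ω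
  have e : ∀ l : List ℕ, (l.map fun j => Γ (j + 2)).prod * invOfUnit (Γ 2) 1 ^ l.length =
      q ^ l.sum := by
    intro l
    induction l with
    | nil => simp
    | cons j l ih =>
      rw [List.map_cons, List.prod_cons, List.length_cons, List.sum_cons,
        pow_add q, ← ih, hq j, pow_succ]
      linear_combination (q ^ j * (l.map fun j => Γ (j + 2)).prod *
        invOfUnit (Γ 2) 1 ^ l.length) * mul_invOfUnit_one h
  exact e l

/-- The partition with the parts of `l`. -/
def ofList (l : List ℕ) (h : ∀ j ∈ l, 0 < j) (h2 : 2 ≤ l.length) : CyclicPartition :=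
  ⟨(l : Cycle ℕ), by simpa using h, by simpa using h2⟩

theorem dressing_ofList (Γ : ℕ → PowerSeries R) (l : List ℕ) (h : ∀ j ∈ l, 0 < j)
    (h2 : 2 ≤ l.length) : dressing Γ (ofList l h h2) =
      (l.map fun j => Γ (j + 2)).prod * invOfUnit (Γ 2) 1 ^ l.length := rfl

/-- The three forms of the relations: equality of dressings of equal weight, constancy of the
ratio of consecutive amplitudes, and the geometric progression. -/
theorem relations_tfae {Γ : ℕ → PowerSeries R} (h : ∀ n, constantCoeff (Γ n) = 1) :
    List.TFAE [
      ∀ ω ω' : CyclicPartition, ω.weight = ω'.weight → dressing Γ ω = dressing Γ ω',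
      ∀ n, 3 ≤ n → Γ (n + 1) * invOfUnit (Γ n) 1 = Γ n * invOfUnit (Γ (n - 1)) 1,
      ∀ j, Γ (j + 2) = Γ 2 * (Γ 3 * invOfUnit (Γ 2) 1) ^ j] := by
  have inv := fun n => mul_invOfUnit_one (h n)
  tfae_have 1 → 2 := by
    intro H n hn
    have key : Γ (n + 1) * Γ (n - 1) = Γ n * Γ n := by
      obtain rfl | hn := hn.eq_or_lt
      · -- for `n = 3` only partitions of different sizes, `(2, 1)` and `(1, 1, 1)`, are available
        have e := H (ofList [2, 1] (by simp) (by simp)) (ofList [1, 1, 1] (by simp) (by simp)) rfl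
        simp only [dressing_ofList, List.map_cons, List.map_nil, List.prod_cons, List.prod_nil,
          List.length_cons, List.length_nil, Nat.reduceAdd, mul_one] at e
        have i3 : IsUnit (Γ 3) := IsUnit.of_mul_eq_one _ (inv 3)
        refine i3.mul_left_cancel ?_
        have e' := congrArg (· * Γ 2 ^ 3) e
        have p2 : invOfUnit (Γ 2) 1 ^ 2 * Γ 2 ^ 2 = 1 := by
          rw [← mul_pow, mul_comm, inv 2, one_pow]
        have p3 : invOfUnit (Γ 2) 1 ^ 3 * Γ 2 ^ 3 = 1 := by
          rw [← mul_pow, mul_comm, inv 2, one_pow]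
        linear_combination e' - (Γ 3 * Γ 4 * Γ 2) * p2 + (Γ 3 ^ 3) * p3
      · -- the partitions `(n - 1, n - 3)` and `(n - 2, n - 2)` of `2 n - 4`
        obtain ⟨m, rfl⟩ : ∃ m, n = m + 4 := ⟨n - 4, by omega⟩
        have e := H (ofList [m + 3, m + 1] (by simp) (by simp))
          (ofList [m + 2, m + 2] (by simp) (by simp)) (by
            change (m + 3) + ((m + 1) + 0) = (m + 2) + ((m + 2) + 0)
            omega)
        simp only [dressing_ofList, List.map_cons, List.map_nil, List.prod_cons, List.prod_nil,
          List.length_cons, List.length_nil, Nat.reduceAdd, mul_one] at e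
        have u : IsUnit (invOfUnit (Γ 2) 1 ^ 2) :=
          (IsUnit.of_mul_eq_one (Γ 2) (by rw [mul_comm, inv])).pow 2
        exact u.mul_right_cancel e
    linear_combination (invOfUnit (Γ n) 1 * invOfUnit (Γ (n - 1)) 1) * key
      - (Γ (n + 1) * invOfUnit (Γ n) 1) * inv (n - 1)
      + (Γ n * invOfUnit (Γ (n - 1)) 1) * inv n
  tfae_have 2 → 3 := by
    intro H
    have ratio : ∀ j, Γ (j + 3) * invOfUnit (Γ (j + 2)) 1 = Γ 3 * invOfUnit (Γ 2) 1 := by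
      intro j
      induction j with
      | zero => rfl
      | succ j ih => exact (H (j + 3) (by omega)).trans ih
    intro j
    induction j with
    | zero => simp
    | succ j ih =>
      rw [pow_succ, ← mul_assoc, ← ih]
      linear_combination Γ (j + 2) * ratio j - Γ (j + 3) * inv (j + 2)
  tfae_have 3 → 1 := by
    intro H ω ω' e
    rw [dressing_eq_pow_weight (h 2) H, dressing_eq_pow_weight (h 2) H, e]
  tfae_finish

/-- A series `Q` is an invariant charge for `Γ` if `X_ω = Γ^|ω| Q` for all skeletons `ω`. -/
def IsInvariantCharge (Γ : ℕ → PowerSeries R) (Q : PowerSeries R) : Prop :=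
  ∀ ω : CyclicPartition, dressing Γ ω = Γ ω.weight * Q

theorem two_le_weight (ω : CyclicPartition) : 2 ≤ ω.weight := by
  obtain ⟨⟨l⟩, hl, h2⟩ := ω
  have e : ∀ l : List ℕ, (∀ j ∈ l, 0 < j) → l.length ≤ l.sum := fun l hl =>
    List.length_le_sum_of_one_le l hl
  exact le_trans h2 (e l hl)

/-- If the relations hold then `Q = q²/Γ²` with `q = Γ³/Γ²` is an invariant charge. -/
theorem isInvariantCharge_of_relations {Γ : ℕ → PowerSeries R}
    (h : ∀ n, constantCoeff (Γ n) = 1)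
    (H : ∀ ω ω' : CyclicPartition, ω.weight = ω'.weight → dressing Γ ω = dressing Γ ω') :
    IsInvariantCharge Γ
      ((Γ 3 * invOfUnit (Γ 2) 1) ^ 2 * invOfUnit (Γ 2) 1) := by
  have H' := ((relations_tfae h).out 0 2).mp H
  intro ω
  obtain ⟨m, hm⟩ := Nat.exists_eq_add_of_le' (two_le_weight ω)
  rw [dressing_eq_pow_weight (h 2) H', hm, H' m, pow_add]
  linear_combination -((Γ 3 * invOfUnit (Γ 2) 1) ^ m * (Γ 3 * invOfUnit (Γ 2) 1) ^ 2) *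
    mul_invOfUnit_one (h 2)

/-! ### Twisted products of series -/

variable {T U : Type*} [CommRing T] [CommRing U]

/-- The product `φ(α) ψ(α Q(α))` formed in a common ring `T` of coefficients, the coefficients of
`φ` and `Q` being sent to it by `f` and those of `ψ` by `g`. -/
noncomputable def twist (f : R →+* T) (g : S →+* T) (Q φ : PowerSeries R) (ψ : PowerSeries S) :
    PowerSeries T :=
  PowerSeries.map f φ * stretch (PowerSeries.map f Q) (PowerSeries.map g ψ)

theorem map_twist (h : T →+* U) (f : R →+* T) (g : S →+* T) (Q φ : PowerSeries R)
    (ψ : PowerSeries S) :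
    PowerSeries.map h (twist f g Q φ ψ) = twist (h.comp f) (h.comp g) Q φ ψ := by
  rw [twist, map_mul, map_stretch]
  rfl

theorem twist_map (f : R →+* T) (g : S →+* T) (h : U →+* S) (Q φ : PowerSeries R)
    (ψ : PowerSeries U) :
    twist f g Q φ (PowerSeries.map h ψ) = twist f (g.comp h) Q φ ψ := rfl

theorem dressing_twist (f : R →+* T) (g : S →+* T) (Q : PowerSeries R) {Φ : ℕ → PowerSeries R}
    {Ψ : ℕ → PowerSeries S} (hΦ : constantCoeff (Φ 2) = 1) (hΨ : constantCoeff (Ψ 2) = 1)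
    (ω : CyclicPartition) : dressing (fun n => twist f g Q (Φ n) (Ψ n)) ω =
      twist f g Q (dressing Φ ω) (dressing Ψ ω) := by
  have hf := constantCoeff_map_eq_one f hΦ
  have hg := constantCoeff_map_eq_one g hΨ
  have hs : constantCoeff (stretch (PowerSeries.map f Q) (PowerSeries.map g (Ψ 2))) = 1 := by
    rw [constantCoeff_stretch, hg]
  have e1 := dressing_mul (Φ := fun n => PowerSeries.map f (Φ n))
    (Ψ := fun n => stretch (PowerSeries.map f Q) (PowerSeries.map g (Ψ n))) hf hs ω
  have e2 := map_dressing (stretch (PowerSeries.map f Q))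
    (Γ := fun n => PowerSeries.map g (Ψ n)) hg hs ω
  refine e1.trans ?_
  rw [twist, map_coeff_dressing f hΦ, map_coeff_dressing g hΨ, e2]

/-- The coefficients of a twisted product lie in any ring containing those of its factors. -/
theorem coeff_twist_mem (f : R →+* T) (g : S →+* T) {A : Subring T} {Q φ : PowerSeries R}
    {ψ : PowerSeries S} (hQ : ∀ k, f (coeff k Q) ∈ A) (hφ : ∀ k, f (coeff k φ) ∈ A)
    (hψ : ∀ k, g (coeff k ψ) ∈ A) (k : ℕ) : coeff k (twist f g Q φ ψ) ∈ A := by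
  obtain ⟨Q', hQ'⟩ := (mem_range_map_iff A (PowerSeries.map f Q)).mpr fun k => by simpa using hQ k
  obtain ⟨φ', hφ'⟩ := (mem_range_map_iff A (PowerSeries.map f φ)).mpr fun k => by simpa using hφ k
  obtain ⟨ψ', hψ'⟩ := (mem_range_map_iff A (PowerSeries.map g ψ)).mpr fun k => by simpa using hψ k
  refine (mem_range_map_iff A _).mp ⟨φ' * stretch Q' ψ', ?_⟩ k
  rw [map_mul, map_stretch, hQ', hφ', hψ', twist]

end Series

/-! ### Solving Dyson-Schwinger equations -/

section Solve

variable {K : Type*} [Field K] {R : Type*} [CommRing R] [Algebra K R]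

/-- A linear operator on a commutative algebra, applied to a series coefficientwise. -/
noncomputable def mapSeries (L : R →ₗ[K] R) (φ : PowerSeries R) : PowerSeries R :=
  PowerSeries.mk fun k => L (coeff k φ)

theorem mapSeries_sub (L : R →ₗ[K] R) (φ ψ : PowerSeries R) :
    mapSeries L (φ - ψ) = mapSeries L φ - mapSeries L ψ := by
  ext k
  simp [mapSeries]

theorem X_pow_dvd_mapSeries (L : R →ₗ[K] R) {φ : PowerSeries R} {k : ℕ}
    (h : (X : PowerSeries R) ^ k ∣ φ) : (X : PowerSeries R) ^ k ∣ mapSeries L φ := by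
  rw [X_pow_dvd_iff] at h ⊢
  intro m hm
  rw [mapSeries, coeff_mk, h m hm, map_zero]

/-- The right-hand side of the Dyson-Schwinger equations with operators `L` and inhomogeneous
terms `a` in place of the tree-level term `1`. -/
noncomputable def dseStep (L : CyclicPartition → R →ₗ[K] R) (a Φ : ℕ → PowerSeries R) (n : ℕ) :
    PowerSeries R :=
  a n + dseSign n • (X * ∑ ω ∈ CyclicPartition.ofWeight n, mapSeries (L ω) (dressing Φ ω))

variable {L : CyclicPartition → R →ₗ[K] R} {a : ℕ → PowerSeries R}

theorem constantCoeff_dseStep (ha : ∀ n, constantCoeff (a n) = 1) (Φ : ℕ → PowerSeries R)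
    (n : ℕ) : constantCoeff (dseStep L a Φ n) = 1 := by
  simp [dseStep, ha]

/-- The right-hand side is a contraction for the `α`-adic distance. -/
theorem dseStep_congr {Φ Ψ : ℕ → PowerSeries R} (hΦ : ∀ n, constantCoeff (Φ n) = 1)
    (hΨ : ∀ n, constantCoeff (Ψ n) = 1) {k : ℕ} (h : ∀ n, (X : PowerSeries R) ^ k ∣ Φ n - Ψ n)
    (n : ℕ) : (X : PowerSeries R) ^ (k + 1) ∣ dseStep L a Φ n - dseStep L a Ψ n := by
  have e : dseStep L a Φ n - dseStep L a Ψ n = dseSign n • (X *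
      ∑ ω ∈ CyclicPartition.ofWeight n, mapSeries (L ω) (dressing Φ ω - dressing Ψ ω)) := by
    simp only [dseStep, mapSeries_sub, Finset.sum_sub_distrib, mul_sub, smul_sub]
    ring
  rw [e, pow_succ']
  exact (mul_dvd_mul_left X (Finset.dvd_sum fun ω _ =>
    X_pow_dvd_mapSeries _ (dressing_congr (hΦ 2) (hΨ 2) h ω))).trans
      (Dvd.intro_left _ (zsmul_eq_mul _ _).symm)

theorem eq_of_forall_X_pow_dvd {φ ψ : PowerSeries R}
    (h : ∀ k, (X : PowerSeries R) ^ k ∣ φ - ψ) : φ = ψ := by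
  ext k
  have := X_pow_dvd_iff.mp (h (k + 1)) k k.lt_succ_self
  rwa [map_sub, sub_eq_zero] at this

theorem dse_unique (ha : ∀ n, constantCoeff (a n) = 1) {Φ Ψ : ℕ → PowerSeries R}
    (hΦ : ∀ n, Φ n = dseStep L a Φ n) (hΨ : ∀ n, Ψ n = dseStep L a Ψ n) : Φ = Ψ := by
  have cΦ : ∀ n, constantCoeff (Φ n) = 1 := fun n => by
    rw [hΦ]; exact constantCoeff_dseStep ha _ _
  have cΨ : ∀ n, constantCoeff (Ψ n) = 1 := fun n => by
    rw [hΨ]; exact constantCoeff_dseStep ha _ _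
  have key : ∀ k n, (X : PowerSeries R) ^ k ∣ Φ n - Ψ n := by
    intro k
    induction k with
    | zero => simp
    | succ k ih =>
      intro n
      rw [hΦ, hΨ]
      exact dseStep_congr cΦ cΨ ih n
  exact funext fun n => eq_of_forall_X_pow_dvd fun k => key k n

/-- The solution is the `α`-adic limit of the iterates of the right-hand side. -/
theorem dse_exists (ha : ∀ n, constantCoeff (a n) = 1) :
    ∃ Φ : ℕ → PowerSeries R, ∀ n, Φ n = dseStep L a Φ n := by
  set it : ℕ → ℕ → PowerSeries R := fun k => (dseStep L a)^[k] fun _ => 1 with hit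
  have hs : ∀ k, it (k + 1) = dseStep L a (it k) := fun k => Function.iterate_succ_apply' _ _ _
  have cit : ∀ k n, constantCoeff (it k n) = 1 := by
    intro k n
    cases k with
    | zero => simp [hit]
    | succ k => rw [hs]; exact constantCoeff_dseStep ha _ _
  have cauchy : ∀ k m n, (X : PowerSeries R) ^ k ∣ it (k + m) n - it k n := by
    intro k m
    induction k with
    | zero => simp
    | succ k ih =>
      intro n
      rw [add_right_comm, hs, hs]
      exact dseStep_congr (cit _) (cit _) ih n
  let Φ : ℕ → PowerSeries R := fun n => PowerSeries.mk fun k => coeff k (it (k + 1) n)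
  have lim : ∀ k n, (X : PowerSeries R) ^ k ∣ Φ n - it k n := by
    intro k n
    rw [X_pow_dvd_iff]
    intro m hm
    obtain ⟨d, rfl⟩ := Nat.exists_eq_add_of_lt hm
    have := X_pow_dvd_iff.mp (cauchy (m + 1) d n) m m.lt_succ_self
    rw [map_sub, sub_eq_zero] at this
    rw [map_sub, coeff_mk, ← this, add_right_comm, sub_self]
  have cΦ : ∀ n, constantCoeff (Φ n) = 1 := fun n => by
    rw [← coeff_zero_eq_constantCoeff_apply, coeff_mk, coeff_zero_eq_constantCoeff_apply, cit]
  refine ⟨Φ, fun n => eq_of_forall_X_pow_dvd fun k => ?_⟩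
  have h1 := (pow_dvd_pow X k.le_succ).trans (lim (k + 1) n)
  have h2 := (pow_dvd_pow X k.le_succ).trans (dseStep_congr (L := L) (a := a) cΦ (cit k) (lim k) n)
  rw [hs] at h1
  simpa using dvd_sub h1 h2

end Solve

/-! ### The coproduct of the amplitudes modulo the relations -/

section Coproduct

variable {K : Type u} [Field K] {H : Type v} [CommRing H] [HopfAlgebra K H]
  {B : CyclicPartition → H →ₗ[K] H} {Γ : ℕ → PowerSeries H}

theorem isGreenSystem_iff :
    IsGreenSystem B Γ ↔ ∀ n, Γ n = dseStep B (fun _ => 1) Γ n := Iff.rfl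

theorem IsGreenSystem.constantCoeff_eq (hΓ : IsGreenSystem B Γ) (n : ℕ) :
    constantCoeff (Γ n) = 1 := by
  rw [isGreenSystem_iff.mp hΓ n]
  exact constantCoeff_dseStep (by simp) _ _

theorem existsUnique_isGreenSystem (B : CyclicPartition → H →ₗ[K] H) :
    ∃! Γ : ℕ → PowerSeries H, IsGreenSystem B Γ := by
  obtain ⟨Γ, hΓ⟩ := dse_exists (L := B) (a := fun _ => 1) (by simp)
  exact ⟨Γ, hΓ, fun Γ' hΓ' => dse_unique (by simp) hΓ' hΓ⟩

variable {C : Type*} [CommRing C] [Algebra K C] (p : H →ₐ[K] C)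

/-- The coproduct followed by a homomorphism `p` on the left tensor factor. -/
noncomputable def leftComul : H →ₐ[K] C ⊗[K] H :=
  (Algebra.TensorProduct.map p (AlgHom.id K H)).comp (Bialgebra.comulAlgHom K H)

/-- The inclusion of the left tensor factor, as a ring homomorphism. -/
noncomputable abbrev inL (K : Type*) [Field K] (C D : Type*) [CommRing C] [Algebra K C]
    [CommRing D] [Algebra K D] : C →+* C ⊗[K] D :=
  (Algebra.TensorProduct.includeLeft : C →ₐ[K] C ⊗[K] D)

/-- The inclusion of the right tensor factor, as a ring homomorphism. -/
noncomputable abbrev inR (K : Type*) [Field K] (C D : Type*) [CommRing C] [Algebra K C]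
    [CommRing D] [Algebra K D] : D →+* C ⊗[K] D :=
  (Algebra.TensorProduct.includeRight : D →ₐ[K] C ⊗[K] D)

/-- The cocycle property only involves `L` on the right factor, so it survives `p` on the left one,
although `L` need not descend along `p`. -/
theorem leftComul_cocycle {L : H →ₗ[K] H} (hL : IsOneCocycle K L) (x : H) :
    leftComul p (L x) = inL K C H (p (L x)) + L.lTensor C (leftComul p x) := by
  have e : ∀ z : H ⊗[K] H, Algebra.TensorProduct.map p (AlgHom.id K H) (L.lTensor H z) =
      L.lTensor C (Algebra.TensorProduct.map p (AlgHom.id K H) z) := by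
    intro z
    induction z with
    | zero => simp
    | add a b ha hb => simp only [map_add, ha, hb]
    | tmul a b => simp
  simp only [leftComul, AlgHom.comp_apply, Bialgebra.comulAlgHom_apply]
  rw [hL x, map_add, e]
  simp

theorem lTensor_inL_mul (L : H →ₗ[K] H) (c : C) (z : C ⊗[K] H) :
    L.lTensor C (inL K C H c * z) = inL K C H c * L.lTensor C z := by
  induction z with
  | zero => simp
  | add a b ha hb => simp only [map_add, mul_add, ha, hb]
  | tmul a b => simp

theorem lTensor_inR (L : H →ₗ[K] H) (x : H) :
    L.lTensor C (inR K C H x) = inR K C H (L x) := by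
  simp

/-- The substitution `α ↦ α Q` with `Q` from the left factor commutes with operators on the right
factor. -/
theorem mapSeries_lTensor (L : H →ₗ[K] H) (Q φ : PowerSeries C) (ψ : PowerSeries H) :
    mapSeries (L.lTensor C) (twist (inL K C H) (inR K C H) Q φ ψ) =
      twist (inL K C H) (inR K C H) Q φ (mapSeries L ψ) := by
  ext k
  simp only [twist, mapSeries, coeff_mk, coeff_mul, map_sum, coeff_map, lTensor_inL_mul]
  refine Finset.sum_congr rfl fun x _ => ?_
  congr 1
  simp only [coeff_stretch, ← map_pow, coeff_map, map_sum, coeff_mk]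
  refine Finset.sum_congr rfl fun j _ => ?_
  rw [mul_comm, lTensor_inL_mul, lTensor_inR, mul_comm]

theorem map_leftComul_mapSeries {L : H →ₗ[K] H} (hL : IsOneCocycle K L) (φ : PowerSeries H) :
    PowerSeries.map (leftComul p : H →+* C ⊗[K] H) (mapSeries L φ) =
      PowerSeries.map (inL K C H) (PowerSeries.map (p : H →+* C) (mapSeries L φ)) +
      mapSeries (L.lTensor C) (PowerSeries.map (leftComul p : H →+* C ⊗[K] H) φ) := by
  ext k
  simpa [mapSeries] using leftComul_cocycle p hL _

/-- The image of the amplitudes under `(p ⊗ id) Δ` solves the Dyson-Schwinger equations for the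
operators `id ⊗ B_+` with inhomogeneous terms `p Γⁿ ⊗ 1`. -/
theorem map_leftComul_green_eq_dseStep (hB : ∀ ω, IsOneCocycle K (B ω))
    (hΓ : IsGreenSystem B Γ) (n : ℕ) :
    PowerSeries.map (leftComul p : H →+* C ⊗[K] H) (Γ n) =
      dseStep (fun ω => (B ω).lTensor C)
        (fun n => PowerSeries.map (inL K C H) (PowerSeries.map (p : H →+* C) (Γ n)))
        (fun n => PowerSeries.map (leftComul p : H →+* C ⊗[K] H) (Γ n)) n := by
  have e := fun ω => map_leftComul_mapSeries p (hB ω) (dressing Γ ω)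
  simp only [dseStep, ← map_coeff_dressing _ (hΓ.constantCoeff_eq 2)]
  conv_lhs => rw [isGreenSystem_iff.mp hΓ n]
  conv_rhs =>
    arg 1
    rw [isGreenSystem_iff.mp hΓ n]
  simp only [dseStep, map_add, map_one, map_zsmul, map_mul, PowerSeries.map_X, map_sum, e,
    Finset.sum_add_distrib, mul_add, smul_add, add_assoc]

/-- If `Q` is an invariant charge of the amplitudes `p Γⁿ`, then `p Γⁿ(α) ⊗ Γⁿ(αQ)` solves the same
equations as `(p ⊗ id) Δ Γⁿ`: the operators `id ⊗ B_+` are linear over the left factor, and the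
factor `α Q` which they meet is the image of `α` under the substitution. -/
theorem twist_green_eq_dseStep (hΓ : IsGreenSystem B Γ) {pΓ : ℕ → PowerSeries C}
    (hp : constantCoeff (pΓ 2) = 1) {Q : PowerSeries C} (hQ : IsInvariantCharge pΓ Q) (n : ℕ) :
    twist (inL K C H) (inR K C H) Q (pΓ n) (Γ n) =
      dseStep (fun ω => (B ω).lTensor C) (fun n => PowerSeries.map (inL K C H) (pΓ n))
        (fun n => twist (inL K C H) (inR K C H) Q (pΓ n) (Γ n)) n := by
  have e : ∀ ω ∈ CyclicPartition.ofWeight n, mapSeries ((B ω).lTensor C)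
      (dressing (fun n => twist (inL K C H) (inR K C H) Q (pΓ n) (Γ n)) ω) =
      PowerSeries.map (inL K C H) (pΓ n) * PowerSeries.map (inL K C H) Q *
        stretch (PowerSeries.map (inL K C H) Q)
          (PowerSeries.map (inR K C H) (mapSeries (B ω) (dressing Γ ω))) := by
    intro ω hω
    have hw : ω.weight = n := by simpa [CyclicPartition.ofWeight] using hω
    rw [dressing_twist _ _ _ hp (hΓ.constantCoeff_eq 2), mapSeries_lTensor, hQ ω, hw, twist,
      map_mul]
  have h : Γ n = 1 + dseSign n • (X * ∑ ω ∈ CyclicPartition.ofWeight n,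
    mapSeries (B ω) (dressing Γ ω)) := hΓ n
  rw [dseStep, Finset.sum_congr rfl e, ← Finset.mul_sum, twist]
  conv_lhs => rw [h]
  simp only [map_add, map_one, map_zsmul, map_mul, PowerSeries.map_X, map_sum, stretch_X,
    mul_add, mul_one]
  congr 1
  simp only [zsmul_eq_mul]
  ring

/-- If the images of the amplitudes under `p` have an invariant charge `Q`, then
`(p ⊗ id) Δ Γⁿ(α) = p Γⁿ(α) ⊗ Γⁿ(αQ)`, by unique solvability of the Dyson-Schwinger equations. -/
theorem map_leftComul_green (hB : ∀ ω, IsOneCocycle K (B ω)) (hΓ : IsGreenSystem B Γ)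
    {Q : PowerSeries C} (hQ : IsInvariantCharge (fun n => PowerSeries.map (p : H →+* C) (Γ n)) Q)
    (n : ℕ) : PowerSeries.map (leftComul p : H →+* C ⊗[K] H) (Γ n) =
      twist (inL K C H) (inR K C H) Q (PowerSeries.map (p : H →+* C) (Γ n)) (Γ n) := by
  have c := fun n => constantCoeff_map_eq_one (p : H →+* C) (hΓ.constantCoeff_eq n)
  exact congrFun (dse_unique (fun n => constantCoeff_map_eq_one _ (c n))
    (map_leftComul_green_eq_dseStep p hB hΓ) (twist_green_eq_dseStep hΓ (c 2) hQ)) n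

end Coproduct

/-! ### Ideals of relations and kernels -/

section Ideals

variable {H S : Type*} [CommRing H] [CommRing S]

theorem map_eq_map_iff (f : H →+* S) (φ ψ : PowerSeries H) :
    PowerSeries.map f φ = PowerSeries.map f ψ ↔ ∀ k, coeff k (φ - ψ) ∈ RingHom.ker f := by
  simp only [PowerSeries.ext_iff, coeff_map, RingHom.mem_ker, map_sub, sub_eq_zero]

theorem relationIdeal_le_ker_iff {Γ : ℕ → PowerSeries H} (c : ∀ n, constantCoeff (Γ n) = 1)
    (f : H →+* S) : relationIdeal Γ ≤ RingHom.ker f ↔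
      ∀ ω ω' : CyclicPartition, ω.weight = ω'.weight →
        dressing (fun n => PowerSeries.map f (Γ n)) ω =
          dressing (fun n => PowerSeries.map f (Γ n)) ω' := by
  simp only [← map_coeff_dressing f (c 2), map_eq_map_iff]
  rw [relationIdeal, Ideal.span_le]
  constructor
  · exact fun h ω ω' e k => h ⟨ω, ω', k, e, rfl⟩
  · rintro h _ ⟨ω, ω', k, e, rfl⟩
    exact h ω ω' e k

theorem ratioIdeal_le_ker_iff {Γ : ℕ → PowerSeries H} (c : ∀ n, constantCoeff (Γ n) = 1)
    (f : H →+* S) : ratioIdeal Γ ≤ RingHom.ker f ↔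
      ∀ n, 3 ≤ n → PowerSeries.map f (Γ (n + 1)) * invOfUnit (PowerSeries.map f (Γ n)) 1 =
        PowerSeries.map f (Γ n) * invOfUnit (PowerSeries.map f (Γ (n - 1))) 1 := by
  have e : ∀ n, invOfUnit (PowerSeries.map f (Γ n)) 1 =
      PowerSeries.map f (invOfUnit (Γ n) 1) := fun n => by
    refine (eq_invOfUnit_one (constantCoeff_map_eq_one f (c n)) ?_).symm
    rw [← map_mul, mul_comm, mul_invOfUnit_one (c n), map_one]
  simp only [e, ← map_mul, map_eq_map_iff]
  rw [ratioIdeal, Ideal.span_le]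
  constructor
  · exact fun h n hn k => h ⟨n, k, hn, rfl⟩
  · rintro h _ ⟨n, k, hn, rfl⟩
    exact h n hn k

theorem relationIdeal_eq_ratioIdeal {Γ : ℕ → PowerSeries H}
    (c : ∀ n, constantCoeff (Γ n) = 1) : relationIdeal Γ = ratioIdeal Γ := by
  have key : ∀ L : Ideal H, relationIdeal Γ ≤ L ↔ ratioIdeal Γ ≤ L := by
    intro L
    have h1 := relationIdeal_le_ker_iff c (Ideal.Quotient.mk L)
    have h2 := ratioIdeal_le_ker_iff c (Ideal.Quotient.mk L)
    rw [Ideal.mk_ker] at h1 h2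
    exact h1.trans (((relations_tfae
      fun n => constantCoeff_map_eq_one _ (c n)).out 0 1).trans h2.symm)
  exact le_antisymm ((key _).mpr le_rfl) ((key _).mp le_rfl)

end Ideals

/-! ### Hopf ideals -/

section HopfIdeals

variable {K : Type u} [Field K] {H : Type v} [CommRing H] [HopfAlgebra K H]

/-- For a commutative Hopf algebra each condition on a Hopf ideal says that it lies in the kernel
of an algebra homomorphism. -/
theorem isHopfIdeal_of_le_ker {N : Ideal H}
    (h1 : N ≤ RingHom.ker (Bialgebra.counitAlgHom K H))
    (h2 : N ≤ RingHom.ker ((Algebra.TensorProduct.map (Ideal.Quotient.mkₐ K N)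
      (Ideal.Quotient.mkₐ K N)).comp (Bialgebra.comulAlgHom K H)))
    (h3 : N ≤ RingHom.ker ((Ideal.Quotient.mkₐ K N).comp (HopfAlgebra.antipodeAlgHom K H))) :
    N.IsHopfIdeal K where
  counit_eq_zero _ hx := h1 hx
  map_mkQ_comul_eq_zero _ hx := h2 hx
  antipode_mem _ hx := Ideal.Quotient.eq_zero_iff_mem.mp (h3 hx)

theorem map_comul_eq_zero {N : Ideal H} (hN : N.IsHopfIdeal K) {M M' : Type*} [AddCommGroup M]
    [Module K M] [AddCommGroup M'] [Module K M'] {f : H →ₗ[K] M} {g : H →ₗ[K] M'}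
    (hf : ∀ x ∈ N, f x = 0) (hg : ∀ x ∈ N, g x = 0) {x : H} (hx : x ∈ N) :
    TensorProduct.map f g (Coalgebra.comul (R := K) x) = 0 := by
  have hf' : N.restrictScalars K ≤ LinearMap.ker f := hf
  have hg' : N.restrictScalars K ≤ LinearMap.ker g := hg
  have e : TensorProduct.map f g = TensorProduct.map ((N.restrictScalars K).liftQ f hf')
      ((N.restrictScalars K).liftQ g hg') ∘ₗ
        TensorProduct.map (N.restrictScalars K).mkQ (N.restrictScalars K).mkQ := by
    rw [← TensorProduct.map_comp, Submodule.liftQ_mkQ, Submodule.liftQ_mkQ]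
  rw [e, LinearMap.comp_apply, hN.map_mkQ_comul_eq_zero hx, map_zero]

theorem isHopfIdeal_sSup {𝒩 : Set (Ideal H)} (h : ∀ N ∈ 𝒩, N.IsHopfIdeal K) :
    (sSup 𝒩).IsHopfIdeal K := by
  have z : ∀ N ∈ 𝒩, ∀ x ∈ N, (Ideal.Quotient.mkₐ K (sSup 𝒩)).toLinearMap x = 0 :=
    fun N hN x hx => Ideal.Quotient.eq_zero_iff_mem.mpr (le_sSup hN hx)
  refine isHopfIdeal_of_le_ker (sSup_le fun N hN x hx => ?_) (sSup_le fun N hN x hx => ?_)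
    (sSup_le fun N hN x hx => ?_)
  · exact (h N hN).counit_eq_zero hx
  · exact map_comul_eq_zero (h N hN) (z N hN) (z N hN) hx
  · exact z N hN _ ((h N hN).antipode_mem hx)

/-- Applying `ε ⊗ ε` to the cocycle identity gives `ε (L x) = ε (L x) + ε (L x)`. -/
theorem IsOneCocycle.counit_eq_zero {L : H →ₗ[K] H} (hL : IsOneCocycle K L) (x : H) :
    Coalgebra.counit (R := K) (L x) = 0 := by
  have e := congrArg (Coalgebra.counit (R := K).lTensor H) (hL x)
  rw [Coalgebra.lTensor_counit_comul, map_add, LinearMap.lTensor_tmul, Bialgebra.counit_one,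
    left_eq_add] at e
  have e' := congrArg
    ((TensorProduct.lid K K).toLinearMap ∘ₗ (Coalgebra.counit (R := K)).rTensor K) e
  rw [map_zero] at e'
  rw [← e']
  have key : ∀ z : H ⊗[K] H,
      ((TensorProduct.lid K K).toLinearMap ∘ₗ (Coalgebra.counit (R := K)).rTensor K)
      ((Coalgebra.counit (R := K)).lTensor H (L.lTensor H z)) =
      (Coalgebra.counit (R := K)) (L (TensorProduct.lid K H
        ((Coalgebra.counit (R := K)).rTensor H z))) := by
    intro z
    induction z with
    | zero => simp
    | add a b ha hb => simp only [map_add, ha, hb]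
    | tmul a b => simp
  rw [key, Coalgebra.rTensor_counit_comul]
  simp

open WithConv in
/-- For a one-cocycle `L`, convolving `id * (S ∘ L) = -L` with the antipode gives
`S ∘ L = -(S * L)`. -/
theorem IsOneCocycle.antipode_apply {L : H →ₗ[K] H} (hL : IsOneCocycle K L) (x : H) :
    HopfAlgebra.antipode K (L x) = -LinearMap.mul' K H
      (TensorProduct.map (HopfAlgebra.antipode K) L (Coalgebra.comul (R := K) x)) := by
  have hconv : ∀ f g : H →ₗ[K] H, (toConv f * toConv g).ofConv =
      LinearMap.mul' K _ ∘ₗ TensorProduct.map f g ∘ₗ Coalgebra.comul (R := K) :=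
    fun f g => rfl
  have h1 : toConv (LinearMap.id (R := K) (M := H)) *
      toConv (HopfAlgebra.antipode K ∘ₗ L) = -toConv L := by
    apply ofConv_injective
    ext x
    have e := HopfAlgebra.mul_antipode_lTensor_comul_apply (R := K) (L x)
    rw [hL x, hL.counit_eq_zero, map_zero, map_add, map_add, LinearMap.lTensor_tmul,
      LinearMap.mul'_apply, HopfAlgebra.antipode_one, mul_one, ← LinearMap.comp_apply
      (LinearMap.lTensor _ _), ← LinearMap.lTensor_comp] at e
    rw [hconv, ofConv_neg]
    exact eq_neg_of_add_eq_zero_right e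
  have h2 : toConv (HopfAlgebra.antipode K ∘ₗ L) =
      -(toConv (HopfAlgebra.antipode K) * toConv L) := by
    rw [← mul_neg, ← h1, ← mul_assoc, LinearMap.antipode_mul_id, one_mul]
  exact congrArg (fun f => f.ofConv x) h2

/-- Adjoining the images of a Hopf ideal under one-cocycles yields a Hopf ideal. -/
theorem isHopfIdeal_sup_span {N : Ideal H} (hN : N.IsHopfIdeal K) {ι : Type*}
    {B : ι → H →ₗ[K] H} (hB : ∀ i, IsOneCocycle K (B i)) :
    (N ⊔ Ideal.span {y | ∃ i, ∃ x ∈ N, y = B i x}).IsHopfIdeal K := by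
  set N' := N ⊔ Ideal.span {y | ∃ i, ∃ x ∈ N, y = B i x} with hN'
  set q := (Ideal.Quotient.mkₐ K N') with hq
  have z : ∀ x ∈ N, q.toLinearMap x = 0 := fun x hx =>
    Ideal.Quotient.eq_zero_iff_mem.mpr (Ideal.mem_sup_left hx)
  have zB : ∀ i, ∀ x ∈ N, (q.toLinearMap ∘ₗ B i) x = 0 := fun i x hx =>
    Ideal.Quotient.eq_zero_iff_mem.mpr (Ideal.mem_sup_right (Ideal.subset_span ⟨i, x, hx, rfl⟩))
  have zS : ∀ x ∈ N, (q.toLinearMap ∘ₗ HopfAlgebra.antipode K) x = 0 := fun x hx =>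
    z _ (hN.antipode_mem hx)
  refine isHopfIdeal_of_le_ker (sup_le ?_ (Ideal.span_le.mpr ?_))
    (sup_le ?_ (Ideal.span_le.mpr ?_)) (sup_le ?_ (Ideal.span_le.mpr ?_))
  · exact fun x hx => hN.counit_eq_zero hx
  · rintro _ ⟨i, x, hx, rfl⟩
    exact (hB i).counit_eq_zero x
  · exact fun x hx => map_comul_eq_zero hN z z hx
  · rintro _ ⟨i, x, hx, rfl⟩
    have e : TensorProduct.map q.toLinearMap q.toLinearMap ((B i).lTensor H
        (Coalgebra.comul (R := K) x)) = TensorProduct.map q.toLinearMap (q.toLinearMap ∘ₗ B i)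
          (Coalgebra.comul (R := K) x) := by
      rw [LinearMap.lTensor, ← LinearMap.comp_apply, ← TensorProduct.map_comp, LinearMap.comp_id]
    change TensorProduct.map q.toLinearMap q.toLinearMap (Coalgebra.comul (R := K) (B i x)) = 0
    have e' : q.toLinearMap (B i x) = 0 := zB i x hx
    rw [hB i x, map_add, e, map_comul_eq_zero hN z (zB i) hx, TensorProduct.map_tmul, e',
      TensorProduct.zero_tmul, add_zero]
  · exact fun x hx => zS x hx
  · rintro _ ⟨i, x, hx, rfl⟩
    change q (HopfAlgebra.antipode K (B i x)) = 0
    have e : ∀ t : H ⊗[K] H, q (LinearMap.mul' K H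
        (TensorProduct.map (HopfAlgebra.antipode K) (B i) t)) = LinearMap.mul' K _
          (TensorProduct.map (q.toLinearMap ∘ₗ HopfAlgebra.antipode K)
            (q.toLinearMap ∘ₗ B i) t) := by
      intro t
      induction t with
      | zero => simp
      | add a b ha hb => simp only [map_add, ha, hb]
      | tmul a b => simp
    rw [(hB i).antipode_apply, map_neg, e, map_comul_eq_zero hN zS (zB i) hx, map_zero, neg_zero]

theorem stableRelationIdeal_le {B : CyclicPartition → H →ₗ[K] H} {Γ : ℕ → PowerSeries H}
    {N : Ideal H} (h : relationIdeal Γ ≤ N) (hN : ∀ ω, ∀ x ∈ N, B ω x ∈ N) :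
    stableRelationIdeal B Γ ≤ N :=
  sInf_le ⟨h, hN⟩

theorem relationIdeal_le_stableRelationIdeal (B : CyclicPartition → H →ₗ[K] H)
    (Γ : ℕ → PowerSeries H) : relationIdeal Γ ≤ stableRelationIdeal B Γ :=
  le_sInf fun _ h => h.1

theorem insertion_mem_stableRelationIdeal {B : CyclicPartition → H →ₗ[K] H}
    {Γ : ℕ → PowerSeries H} (ω : CyclicPartition) {x : H} (hx : x ∈ stableRelationIdeal B Γ) :
    B ω x ∈ stableRelationIdeal B Γ := by
  rw [stableRelationIdeal, Submodule.mem_sInf] at hx ⊢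
  exact fun N hN => hN.2 ω x (hx N hN)

/-- If the relations generate a Hopf ideal, then so does their closure under one-cocycles: the
largest Hopf ideal inside the closure is stable, because adjoining its images under the
one-cocycles does not lead out of the closure. -/
theorem isHopfIdeal_stableRelationIdeal {B : CyclicPartition → H →ₗ[K] H}
    (hB : ∀ ω, IsOneCocycle K (B ω)) {Γ : ℕ → PowerSeries H}
    (hI : (relationIdeal Γ).IsHopfIdeal K) : (stableRelationIdeal B Γ).IsHopfIdeal K := by
  set N : Ideal H := sSup {N | N ≤ stableRelationIdeal B Γ ∧ N.IsHopfIdeal K} with hN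
  have hopf : N.IsHopfIdeal K := isHopfIdeal_sSup fun N hN => hN.2
  have le : N ≤ stableRelationIdeal B Γ := sSup_le fun N hN => hN.1
  have ge : stableRelationIdeal B Γ ≤ N := by
    refine stableRelationIdeal_le
      (le_sSup ⟨relationIdeal_le_stableRelationIdeal B Γ, hI⟩) fun ω x hx => ?_
    have h' : N ⊔ Ideal.span {y | ∃ ω, ∃ x ∈ N, y = B ω x} ≤ N := by
      refine le_sSup ⟨sup_le le (Ideal.span_le.mpr ?_), isHopfIdeal_sup_span hopf hB⟩
      rintro _ ⟨ω, x, hx, rfl⟩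
      exact insertion_mem_stableRelationIdeal ω (le hx)
    exact h' (Ideal.mem_sup_right (Ideal.subset_span ⟨ω, x, hx, rfl⟩))
  rwa [le_antisymm ge le]

end HopfIdeals

/-! ### The relations form a Hopf ideal -/

section Relations

variable {K : Type u} [Field K] {H : Type v} [CommRing H] [HopfAlgebra K H]
  {B : CyclicPartition → H →ₗ[K] H} {Γ : ℕ → PowerSeries H}

theorem map_counit_green (hB : ∀ ω, IsOneCocycle K (B ω)) (hΓ : IsGreenSystem B Γ) (n : ℕ) :
    PowerSeries.map (Bialgebra.counitAlgHom K H : H →+* K) (Γ n) = 1 := by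
  ext k
  rw [coeff_map, coeff_one]
  split_ifs with hk
  · rw [hk, coeff_zero_eq_constantCoeff_apply, hΓ.constantCoeff_eq, map_one]
  · obtain ⟨k, rfl⟩ := Nat.exists_eq_succ_of_ne_zero hk
    rw [isGreenSystem_iff.mp hΓ n, dseStep, map_add, map_zsmul, Nat.succ_eq_add_one,
      coeff_succ_X_mul, map_sum, coeff_one, if_neg hk, zero_add, map_zsmul, map_sum,
      Finset.sum_eq_zero, smul_zero]
    intro ω _
    rw [mapSeries, coeff_mk]
    exact (hB ω).counit_eq_zero _

section

variable {C : Type*} [CommRing C] [Algebra K C] (p : H →ₐ[K] C)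

/-- The coproduct formula with `p` applied to both tensor factors. -/
theorem map_map_comul_green (hB : ∀ ω, IsOneCocycle K (B ω)) (hΓ : IsGreenSystem B Γ)
    {Q : PowerSeries C} (hQ : IsInvariantCharge (fun n => PowerSeries.map (p : H →+* C) (Γ n)) Q)
    (n : ℕ) : PowerSeries.map (((Algebra.TensorProduct.map p p).comp
        (Bialgebra.comulAlgHom K H) : H →ₐ[K] C ⊗[K] C) : H →+* C ⊗[K] C) (Γ n) =
      twist (inL K C C) (inR K C C) Q (PowerSeries.map (p : H →+* C) (Γ n))
        (PowerSeries.map (p : H →+* C) (Γ n)) := by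
  have e : ((Algebra.TensorProduct.map p p).comp (Bialgebra.comulAlgHom K H)) =
      (Algebra.TensorProduct.map (AlgHom.id K C) p).comp (leftComul p) := by
    rw [leftComul, ← AlgHom.comp_assoc, ← Algebra.TensorProduct.map_comp, AlgHom.id_comp,
      AlgHom.comp_id]
  have e' : PowerSeries.map (((Algebra.TensorProduct.map p p).comp
        (Bialgebra.comulAlgHom K H) : H →ₐ[K] C ⊗[K] C) : H →+* C ⊗[K] C) (Γ n) =
      PowerSeries.map (Algebra.TensorProduct.map (AlgHom.id K C) p : C ⊗[K] H →+* C ⊗[K] C)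
        (PowerSeries.map (leftComul p : H →+* C ⊗[K] H) (Γ n)) := by
    rw [e]; rfl
  have hl : (Algebra.TensorProduct.map (AlgHom.id K C) p : C ⊗[K] H →+* C ⊗[K] C).comp
      (inL K C H) = inL K C C := by ext; simp
  have hr : (Algebra.TensorProduct.map (AlgHom.id K C) p : C ⊗[K] H →+* C ⊗[K] C).comp
      (inR K C H) = (inR K C C).comp (p : H →+* C) := by ext; simp
  rw [e', map_leftComul_green p hB hΓ hQ, map_twist, hl, hr, twist_map]

/-- Contracting the coproduct formula with the antipode: `p Γⁿ(α) · (p S Γⁿ)(αQ) = 1`. -/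
theorem twist_antipode_green (hB : ∀ ω, IsOneCocycle K (B ω)) (hΓ : IsGreenSystem B Γ)
    {Q : PowerSeries C} (hQ : IsInvariantCharge (fun n => PowerSeries.map (p : H →+* C) (Γ n)) Q)
    (n : ℕ) : PowerSeries.map (p : H →+* C) (Γ n) * stretch Q
      (PowerSeries.map (p.comp (HopfAlgebra.antipodeAlgHom K H) : H →+* C) (Γ n)) = 1 := by
  set pS : H →ₐ[K] C := p.comp (HopfAlgebra.antipodeAlgHom K H) with hpS
  set m : C ⊗[K] H →ₐ[K] C := Algebra.TensorProduct.lift (AlgHom.id K C) pS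
    (fun _ _ => Commute.all _ _) with hm
  have hl : (m : C ⊗[K] H →+* C).comp (inL K C H) = RingHom.id C := by ext; simp [hm]
  have hr : (m : C ⊗[K] H →+* C).comp (inR K C H) = (pS : H →+* C) := by ext; simp [hm]
  have key : ∀ x, m (leftComul p x) = algebraMap K C (Coalgebra.counit (R := K) x) := by
    intro x
    have e : ∀ z : H ⊗[K] H, m (Algebra.TensorProduct.map p (AlgHom.id K H) z) =
        p (LinearMap.mul' K H ((HopfAlgebra.antipode K).lTensor H z)) := by
      intro z
      induction z with
      | zero => simp
      | add a b ha hb => simp only [map_add, ha, hb]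
      | tmul a b => simp [hm, hpS]
    rw [leftComul, AlgHom.comp_apply, e]
    simp
  have h := congrArg (PowerSeries.map (m : C ⊗[K] H →+* C)) (map_leftComul_green p hB hΓ hQ n)
  rw [map_twist, hl, hr, twist, PowerSeries.map_id] at h
  refine h.symm.trans ?_
  have hε : ((m : C ⊗[K] H →+* C).comp (leftComul p : H →+* C ⊗[K] H)) =
      (algebraMap K C).comp (Bialgebra.counitAlgHom K H : H →+* K) :=
    RingHom.ext fun x => key x
  calc PowerSeries.map (m : C ⊗[K] H →+* C) (PowerSeries.map (leftComul p : H →+* C ⊗[K] H) (Γ n))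
      = PowerSeries.map ((m : C ⊗[K] H →+* C).comp (leftComul p : H →+* C ⊗[K] H)) (Γ n) := rfl
    _ = PowerSeries.map (algebraMap K C)
          (PowerSeries.map (Bialgebra.counitAlgHom K H : H →+* K) (Γ n)) := by rw [hε]; rfl
    _ = 1 := by rw [map_counit_green hB hΓ, map_one]

/-! Each condition on a Hopf ideal holds for the relations, since the series which the coproduct
and antipode formulas assign to `X_ω` only depend on `p X_ω`, hence on `|ω|`. -/

theorem relationIdeal_le_ker_counit (hB : ∀ ω, IsOneCocycle K (B ω)) (hΓ : IsGreenSystem B Γ) :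
    relationIdeal Γ ≤ RingHom.ker (Bialgebra.counitAlgHom K H : H →+* K) := by
  refine (relationIdeal_le_ker_iff hΓ.constantCoeff_eq _).mpr fun ω ω' _ => ?_
  simp only [map_counit_green hB hΓ, dressing_one]

theorem relationIdeal_le_ker_comul (hB : ∀ ω, IsOneCocycle K (B ω)) (hΓ : IsGreenSystem B Γ)
    {Q : PowerSeries C} (hQ : IsInvariantCharge (fun n => PowerSeries.map (p : H →+* C) (Γ n)) Q) :
    relationIdeal Γ ≤ RingHom.ker (((Algebra.TensorProduct.map p p).comp
      (Bialgebra.comulAlgHom K H) : H →ₐ[K] C ⊗[K] C) : H →+* C ⊗[K] C) := by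
  refine (relationIdeal_le_ker_iff hΓ.constantCoeff_eq _).mpr fun ω ω' h => ?_
  have cp := constantCoeff_map_eq_one (p : H →+* C) (hΓ.constantCoeff_eq 2)
  have e := hQ ω
  rw [h, ← hQ ω'] at e
  simp only [map_map_comul_green p hB hΓ hQ]
  rw [dressing_twist _ _ _ cp cp, dressing_twist _ _ _ cp cp, e]

theorem relationIdeal_le_ker_antipode (hB : ∀ ω, IsOneCocycle K (B ω)) (hΓ : IsGreenSystem B Γ)
    {Q : PowerSeries C} (hQ : IsInvariantCharge (fun n => PowerSeries.map (p : H →+* C) (Γ n)) Q)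
    (cQ : constantCoeff Q = 1) :
    relationIdeal Γ ≤ RingHom.ker (p.comp (HopfAlgebra.antipodeAlgHom K H) : H →+* C) := by
  refine (relationIdeal_le_ker_iff hΓ.constantCoeff_eq _).mpr fun ω ω' h => ?_
  set pS : H →+* C := (p.comp (HopfAlgebra.antipodeAlgHom K H) : H →+* C) with hpS
  have cp := constantCoeff_map_eq_one (p : H →+* C) (hΓ.constantCoeff_eq 2)
  have cS := constantCoeff_map_eq_one pS (hΓ.constantCoeff_eq 2)
  have cs := (constantCoeff_stretch Q _).trans cS
  have inv : ∀ ω, dressing (fun n => PowerSeries.map (p : H →+* C) (Γ n)) ω *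
      stretch Q (dressing (fun n => PowerSeries.map pS (Γ n)) ω) = 1 := by
    intro ω
    have e1 := map_dressing (stretch Q) (Γ := fun n => PowerSeries.map pS (Γ n)) cS cs ω
    have e2 := dressing_mul (Φ := fun n => PowerSeries.map (p : H →+* C) (Γ n))
      (Ψ := fun n => stretch Q (PowerSeries.map pS (Γ n))) cp cs ω
    rw [e1, ← e2, funext fun n => twist_antipode_green p hB hΓ hQ n]
    exact dressing_one ω
  have inv' := inv ω'
  rw [hQ ω', ← h, ← hQ ω] at inv'
  exact stretch_injective cQ (left_inv_eq_right_inv ((mul_comm _ _).trans (inv ω)) inv')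

end

theorem isInvariantCharge_quotient (hΓ : IsGreenSystem B Γ) {N : Ideal H}
    (hN : relationIdeal Γ ≤ N) : IsInvariantCharge (quotientGreen N Γ)
      ((quotientGreen N Γ 3 * invOfUnit (quotientGreen N Γ 2) 1) ^ 2 *
        invOfUnit (quotientGreen N Γ 2) 1) := by
  refine isInvariantCharge_of_relations
    (fun n => constantCoeff_map_eq_one _ (hΓ.constantCoeff_eq n)) ?_
  refine (relationIdeal_le_ker_iff hΓ.constantCoeff_eq (Ideal.Quotient.mk N)).mp ?_
  rwa [Ideal.mk_ker]

theorem constantCoeff_quotientGreen (hΓ : IsGreenSystem B Γ) (N : Ideal H) (n : ℕ) :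
    constantCoeff (quotientGreen N Γ n) = 1 :=
  constantCoeff_map_eq_one _ (hΓ.constantCoeff_eq n)

theorem isHopfIdeal_relationIdeal (hB : ∀ ω, IsOneCocycle K (B ω)) (hΓ : IsGreenSystem B Γ) :
    (relationIdeal Γ).IsHopfIdeal K := by
  have hQ := isInvariantCharge_quotient hΓ (le_refl (relationIdeal Γ))
  refine isHopfIdeal_of_le_ker (relationIdeal_le_ker_counit hB hΓ)
    (relationIdeal_le_ker_comul (Ideal.Quotient.mkₐ K _) hB hΓ hQ)
    (relationIdeal_le_ker_antipode (Ideal.Quotient.mkₐ K _) hB hΓ hQ ?_)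
  simp [constantCoeff_quotientGreen hΓ]

/-! ### The sub-Hopf algebra generated by the amplitudes -/

/-- Modulo a Hopf ideal which contains the relations, the invariant charge is a rational function
of the amplitudes, so the coproduct formula shows `Δ A ⊆ A ⊗ A`, and `S A ⊆ A` follows by solving
`Γⁿ(α) · S Γⁿ(αQ) = 1` order by order. -/
theorem isSubHopfAlgebra_greenSubalgebra (hB : ∀ ω, IsOneCocycle K (B ω))
    (hΓ : IsGreenSystem B Γ) {N : Ideal H} [hN : N.IsHopfIdeal K] (hle : relationIdeal Γ ≤ N) :
    IsSubHopfAlgebra K (greenSubalgebra K (quotientGreen N Γ)) := by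
  have c := constantCoeff_quotientGreen hΓ N
  set A := greenSubalgebra K (quotientGreen N Γ) with hA
  have hQ := isInvariantCharge_quotient hΓ hle
  set Q := (quotientGreen N Γ 3 * invOfUnit (quotientGreen N Γ 2) 1) ^ 2 *
      invOfUnit (quotientGreen N Γ 2) 1 with hQd
  have cQ : constantCoeff Q = 1 := by simp [hQd, c]
  have memΓ : ∀ n, 2 ≤ n → quotientGreen N Γ n ∈
      (PowerSeries.map A.toSubring.subtype).range := fun n hn =>
    (mem_range_map_iff A.toSubring _).mpr fun k =>
      Algebra.subset_adjoin ⟨n, k, hn, rfl⟩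
  have inv : ∀ n, 2 ≤ n → invOfUnit (quotientGreen N Γ n) 1 ∈
      (PowerSeries.map A.toSubring.subtype).range := fun n hn =>
    invOfUnit_mem_range_map A.toSubring.subtype Subtype.val_injective (c n) (memΓ n hn)
  have memQ : Q ∈ (PowerSeries.map A.toSubring.subtype).range :=
    mul_mem (pow_mem (mul_mem (memΓ 3 (by norm_num)) (inv 2 le_rfl)) 2) (inv 2 le_rfl)
  have memΓ' := fun n hn => (mem_range_map_iff A.toSubring _).mp (memΓ n hn)
  have memQ' := (mem_range_map_iff A.toSubring _).mp memQ
  set T : Subalgebra K ((H ⧸ N) ⊗[K] (H ⧸ N)) :=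
    (Algebra.TensorProduct.map A.val A.val).range with hT
  have memL : ∀ a ∈ A, inL K (H ⧸ N) (H ⧸ N) a ∈ T.toSubring := fun a ha =>
    ⟨(⟨a, ha⟩ : A) ⊗ₜ 1, by simp⟩
  have memR : ∀ a ∈ A, inR K (H ⧸ N) (H ⧸ N) a ∈ T.toSubring := fun a ha =>
    ⟨1 ⊗ₜ (⟨a, ha⟩ : A), by simp⟩
  constructor
  · have le : A ≤ T.comap (Bialgebra.comulAlgHom K (H ⧸ N)) := by
      refine Algebra.adjoin_le ?_
      rintro _ ⟨n, k, hn, rfl⟩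
      have e := congrArg (coeff k) (map_map_comul_green (Ideal.Quotient.mkₐ K N) hB hΓ hQ n)
      rw [coeff_map] at e
      have m := coeff_twist_mem (inL K (H ⧸ N) (H ⧸ N)) (inR K (H ⧸ N) (H ⧸ N))
        (A := T.toSubring) (fun k => memL _ (memQ' k)) (fun k => memL _ (memΓ' n hn k))
        (fun k => memR _ (memΓ' n hn k)) k
      exact (congrArg (· ∈ T) e).mpr m
    exact fun a ha => le ha
  · have le : A ≤ A.comap (HopfAlgebra.antipodeAlgHom K (H ⧸ N)) := by
      refine Algebra.adjoin_le ?_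
      rintro _ ⟨n, k, hn, rfl⟩
      have e := twist_antipode_green (Ideal.Quotient.mkₐ K N) hB hΓ hQ n
      have e' := eq_invOfUnit_one (c n) ((mul_comm _ _).trans e)
      exact coeff_mem_of_stretch (A := A.toSubring) cQ memQ (e' ▸ inv n hn) k
    exact fun a ha => le ha

/-! ### The quotient by the stable ideal -/

theorem isOneCocycle_oneLoop (hB : ∀ ω, IsOneCocycle K (B ω)) (n : ℕ) :
    IsOneCocycle K (oneLoop B n) := by
  intro x
  rw [oneLoop, LinearMap.sum_apply, map_sum, Finset.sum_congr rfl fun ω _ => hB ω x,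
    Finset.sum_add_distrib, ← TensorProduct.sum_tmul]
  congr 1
  rw [← LinearMap.coe_lTensorHom, map_sum, LinearMap.sum_apply]

theorem isOneCocycle_of_quotient {N : Ideal H} [N.IsHopfIdeal K] {L : H →ₗ[K] H}
    (hL : IsOneCocycle K L) {L' : (H ⧸ N) →ₗ[K] (H ⧸ N)}
    (h : ∀ x, L' (Ideal.Quotient.mk N x) = Ideal.Quotient.mk N (L x)) : IsOneCocycle K L' := by
  intro x
  obtain ⟨x, rfl⟩ := Ideal.Quotient.mk_surjective x
  set q := (Ideal.Quotient.mkₐ K N).toLinearMap with hq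
  have e : ∀ z : H ⊗[K] H, TensorProduct.map q q (L.lTensor H z) =
      L'.lTensor (H ⧸ N) (TensorProduct.map q q z) := by
    intro z
    induction z with
    | zero => simp
    | add a b ha hb => simp only [map_add, ha, hb]
    | tmul a b =>
      simp only [LinearMap.lTensor_tmul, TensorProduct.map_tmul]
      congr 1
      exact (h b).symm
  rw [h, Bialgebra.Quotient.comul_mk, Bialgebra.Quotient.comul_mk, ← hq, hL x, map_add, e]
  congr 1

theorem map_mapCoeff {N : Ideal H} [N.IsHopfIdeal K] {L : H →ₗ[K] H}
    {L' : (H ⧸ N) →ₗ[K] (H ⧸ N)}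
    (h : ∀ x, L' (Ideal.Quotient.mk N x) = Ideal.Quotient.mk N (L x)) (φ : PowerSeries H) :
    PowerSeries.map (Ideal.Quotient.mk N) (mapCoeff L φ) =
      mapCoeff L' (PowerSeries.map (Ideal.Quotient.mk N) φ) := by
  ext k
  simp [mapCoeff, h]

theorem mapCoeff_oneLoop (B : CyclicPartition → H →ₗ[K] H) (n : ℕ) (φ : PowerSeries H) :
    mapCoeff (oneLoop B n) φ = ∑ ω ∈ CyclicPartition.ofWeight n, mapCoeff (B ω) φ := by
  ext k
  simp [mapCoeff, oneLoop]

/-- In a quotient to which the operators descend and where all dressings of equal weight agree,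
`B_+^{1,n}` applied to any one of them gives the loop corrections to the amplitude. -/
theorem quotientGreen_eq_oneLoop (hΓ : IsGreenSystem B Γ) {N : Ideal H} [N.IsHopfIdeal K]
    (hle : relationIdeal Γ ≤ N) {B' : CyclicPartition → (H ⧸ N) →ₗ[K] (H ⧸ N)}
    (h : ∀ ω x, B' ω (Ideal.Quotient.mk N x) = Ideal.Quotient.mk N (B ω x))
    (ω : CyclicPartition) : quotientGreen N Γ ω.weight = 1 + dseSign ω.weight •
      (PowerSeries.X * mapCoeff (oneLoop B' ω.weight) (dressing (quotientGreen N Γ) ω)) := by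
  have e : ∀ ω' ∈ CyclicPartition.ofWeight ω.weight,
      PowerSeries.map (Ideal.Quotient.mk N) (mapCoeff (B ω') (dressing Γ ω')) =
        mapCoeff (B' ω') (dressing (quotientGreen N Γ) ω) := by
    intro ω' hω'
    have hw : ω'.weight = ω.weight := by simpa [CyclicPartition.ofWeight] using hω'
    have hQ := isInvariantCharge_quotient hΓ hle
    have hd : dressing (quotientGreen N Γ) ω' = dressing (quotientGreen N Γ) ω := by
      rw [hQ ω', hw, ← hQ ω]
    rw [map_mapCoeff (h ω'), map_coeff_dressing _ (hΓ.constantCoeff_eq 2), ← hd]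
    rfl
  rw [mapCoeff_oneLoop, ← Finset.sum_congr rfl e, ← map_sum]
  conv_lhs => rw [quotientGreen, hΓ ω.weight]
  rw [map_add, map_one, map_zsmul, map_mul, PowerSeries.map_X]

theorem slavnovTaylor (hB : ∀ ω, IsOneCocycle K (B ω)) : SlavnovTaylor B := by
  refine ⟨isOneCocycle_oneLoop hB, existsUnique_isGreenSystem B, fun Γ hΓ => ?_⟩
  have hI := isHopfIdeal_relationIdeal hB hΓ
  have hJ := isHopfIdeal_stableRelationIdeal hB hI
  have hle := relationIdeal_le_stableRelationIdeal B Γ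
  set J := stableRelationIdeal B Γ with hJd
  let B' : CyclicPartition → (H ⧸ J) →ₗ[K] (H ⧸ J) := fun ω =>
    Submodule.mapQ (J.restrictScalars K) (J.restrictScalars K) (B ω)
      fun _ hx => insertion_mem_stableRelationIdeal ω hx
  have hB' : ∀ ω x, B' ω (Ideal.Quotient.mk J x) = Ideal.Quotient.mk J (B ω x) :=
    fun _ _ => rfl
  exact ⟨relationIdeal_eq_ratioIdeal hΓ.constantCoeff_eq,
    ⟨hI, isSubHopfAlgebra_greenSubalgebra hB hΓ le_rfl⟩,
    ⟨hJ, isSubHopfAlgebra_greenSubalgebra hB hΓ hle, B', hB',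
      isOneCocycle_oneLoop fun ω => isOneCocycle_of_quotient (hB ω) (hB' ω),
      quotientGreen_eq_oneLoop hΓ hle hB'⟩⟩

end Relations

end Gravity

theorem mainTheorem2 (K : Type u) [Field K] :
    (∀ ω : Gravity.CyclicPartition,
      Gravity.IsOneCocycle K (Gravity.InsertionAlgebra.insertion K ω)) ∧
    Gravity.SlavnovTaylor (Gravity.InsertionAlgebra.insertion K) ∧
    ∀ (H : Type v) [CommRing H] [HopfAlgebra K H]
      (B : Gravity.CyclicPartition → H →ₗ[K] H),
      (∀ ω, Gravity.IsOneCocycle K (B ω)) → Gravity.SlavnovTaylor B := by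
  exact ⟨Gravity.InsertionAlgebra.isOneCocycleAux K,
    Gravity.slavnovTaylor (Gravity.InsertionAlgebra.isOneCocycleAux K),
    fun _ _ _ _ hB => Gravity.slavnovTaylor hB⟩
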